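/- Let $L\ge 1$ and, for $2\le k\le L$, let $\lambda_k,\mu_k,a_k>0$ with $\rho_k:=\lambda_k/\mu_k<1$. (They are the arrival rates, inverse mean flow sizes and access rates of the local classes $2,\dots,L$ of a linear network with $L$ links of unit capacity, under tail dropping; class $k$ uses link $k$ only and class $0$ uses all links.) Minima over an empty index set are omitted below. For $\alpha\in[0,1]$ and $x=(x_2,\dots,x_L)\in\mathbb R_+^{L-1}$ put $\tilde\theta_0^1(\alpha,x)=\alpha$ and, for $2\le k\le L$, $$\tilde\theta_0^k=\min\Bigl(\tilde\theta_0^{k-1},\frac{\tilde\theta_0^{k-1}}{\tilde\theta_0^{k-1}+x_k}\Bigr),\qquad \tilde\psi_k(\alpha,x)=\min\Bigl(x_k,\frac{x_k}{\tilde\theta_0^{k-1}+x_k}\Bigr),\qquad \tilde\psi_0(\alpha,x)=\tilde\theta_0^L(\alpha,x)$$ (a quotient $0/0$ being read as $0$). For $\alpha\in[0,1]$ and an integer $\beta\ge 1$ let $\tilde N^\alpha_\beta$ be the Markov jump process on $\mathbb N^{L-1}$ with transition rates, for $2\le k\le L$, $$n\to n+e_k:\ \beta\lambda_k,\qquad n\to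 n-e_k:\ \beta\mu_k\,\tilde\psi_k\bigl(\alpha,(\beta^{-1}a_jn_j)_{2\le j\le L}\bigr).$$ Then $\tilde N^\alpha_\beta$ has a unique stationary distribution. Let $\tilde\pi^\alpha_\beta$ be the corresponding stationary distribution of the scaled process $(\beta^{-1}a_k\tilde N^\alpha_{\beta,k})_{2\le k\le L}$, and let $\bar\phi_{0,\beta}(\alpha)=\int\tilde\psi_0(\alpha,x)\,\tilde\pi^\alpha_\beta(dx)$. The vector $\gamma(\alpha)$ with $$\gamma_k(\alpha)=\max\Bigl(\rho_k,\ \frac{\rho_k}{1-\rho_k}\min\bigl(\alpha,\min_{2\le j\le k-1}(1-\rho_j)\bigr)\Bigr),\qquad 2\le k\le L,$$ is the unique solution $x\in\mathbb R_+^{L-1}$ of $\lambda_k-\mu_k\tilde\psi_k(\alpha,x)=0$, $2\le k\le L$, and the following hold. 1. The set $\{\tilde\pi^\alpha_\beta:\ \alpha\in[0,1],\ \beta\in\mathbb N,\ \beta\ge1\}$ is tight. 2. For every $\alpha\in[0,1]$, $\tilde\pi^\alpha_\beta$ converges weakly to the Dirac measure $\delta_{\gamma(\alpha)}$ as $\beta\to\infty$.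 3. For every $\alpha\in[0,1]$, $\bar\phi_{0,\beta}(\alpha)\to\bar\phi_{0,\infty}(\alpha):=\min\bigl(\alpha,\min_{2\le k\le L}(1-\rho_k)\bigr)$ as $\beta\to\infty$. 4. For every $\alpha\in[0,1]$, $\inf_{\alpha\le u\le1}\bar\phi_{0,\beta}(u)\to\bar\phi_{0,\infty}(\alpha)$ as $\beta\to\infty$. -/

import Mathlib

open MeasureTheory Filter Topology
open scoped BoundedContinuousFunction

/-- Parameters of the classes `2, …, L` of a linear network with `L = m + 1` links of capacity `1`.
The index `k : Fin m` stands for class `k + 2`, which only uses link `k + 2`: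
arrival rate `lam k`, mean flow size `1 / mu k`, access rate `a k`. -/
structure LinearNetwork (m : ℕ) where
  lam : Fin m → ℝ
  mu : Fin m → ℝ
  a : Fin m → ℝ
  lam_pos : ∀ k, 0 < lam k
  mu_pos : ∀ k, 0 < mu k
  a_pos : ∀ k, 0 < a k

namespace LinearNetwork

/-- The exponential of a bounded operator. -/
noncomputable def expOp {E : Type*} [NormedAddCommGroup E] [NormedSpace ℝ E] (A : E →L[ℝ] E) :
    E →L[ℝ] E := NormedSpace.exp A

variable {m : ℕ}

/-- Tail dropping on a link of capacity `1`: output rate of a class with input rate `y`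
when the other class on the link has input rate `z`. -/
noncomputable def tailDrop (y z : ℝ) : ℝ := min y (y / (y + z))

/-- Rates of class `0` along links `1, …, L` when its rate after link `1` is `α` and the input
rates of classes `2, …, L` are `x`: `theta α x k.castSucc` is the rate at the input of the link used
by class `k`, `theta α x k.succ` the rate at its output. -/
noncomputable def theta (α : ℝ) (x : Fin m → ℝ) : Fin (m + 1) → ℝ :=
  Fin.induction α (fun k y => tailDrop y (x k))

/-- Throughput of class `k`. -/
noncomputable def psi (α : ℝ) (x : Fin m → ℝ) (k : Fin m) : ℝ :=
  tailDrop (x k) (theta α x k.castSucc)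

/-- Throughput of class `0`. -/
noncomputable def psiZero (α : ℝ) (x : Fin m → ℝ) : ℝ := theta α x (Fin.last m)

lemma theta_nonneg {α : ℝ} (hα : 0 ≤ α) {x : Fin m → ℝ} (hx : ∀ k, 0 ≤ x k) (i : Fin (m + 1)) :
    0 ≤ theta α x i := by
  induction i using Fin.induction with
  | zero => simpa [theta] using hα
  | succ k ih =>
    have h : theta α x k.succ = tailDrop (theta α x k.castSucc) (x k) := by
      simp [theta]
    rw [h]
    exact le_min ih (div_nonneg ih (add_nonneg ih (hx k)))

lemma abs_psi_le_one {α : ℝ} (hα : 0 ≤ α) {x : Fin m → ℝ} (hx : ∀ k, 0 ≤ x k) (k : Fin m) :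
    |psi α x k| ≤ 1 := by
  have h0 := theta_nonneg hα hx k.castSucc
  have hd := div_nonneg (hx k) (add_nonneg (hx k) h0)
  unfold psi tailDrop
  rw [abs_of_nonneg (le_min (hx k) hd)]
  exact (min_le_right _ _).trans (div_le_one_of_le₀ (by linarith) (add_nonneg (hx k) h0))

variable (p : LinearNetwork m)

/-- Traffic intensities. -/
noncomputable def rho (k : Fin m) : ℝ := p.lam k / p.mu k

/-- The vector of input rates `β⁻¹ a ⊙ n`. -/
noncomputable def scale (β : ℕ) (n : Fin m → ℕ) : Fin m → ℝ := fun k => (β : ℝ)⁻¹ * p.a k * n k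

lemma scale_nonneg (β : ℕ) (n : Fin m → ℕ) (k : Fin m) : 0 ≤ p.scale β n k := by
  have := (p.a_pos k).le
  unfold scale
  positivity

/-- `∑ₖ βλₖ (f(n + eₖ) - f(n)) + ∑ₖ βμₖ ψₖ(α, β⁻¹ a ⊙ n) (f(n - eₖ) - f(n))`.
The truncated subtraction is harmless, since `ψₖ` vanishes when `nₖ = 0`. -/
noncomputable def genFun (α : unitInterval) (β : ℕ) (f : (Fin m → ℕ) → ℝ) (n : Fin m → ℕ) : ℝ :=
  ∑ k, (β * p.lam k * (f (n + Pi.single k 1) - f n)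
    + β * p.mu k * psi α (p.scale β n) k * (f (n - Pi.single k 1) - f n))

lemma abs_genFun_le (α : unitInterval) (β : ℕ) (f : (Fin m → ℕ) →ᵇ ℝ) (n : Fin m → ℕ) :
    |p.genFun α β f n| ≤ (∑ k, (2 * β * p.lam k + 2 * β * p.mu k)) * ‖f‖ := by
  unfold genFun
  rw [Finset.sum_mul]
  refine (Finset.abs_sum_le_sum_abs _ _).trans (Finset.sum_le_sum fun k _ => ?_)
  have hd : ∀ n', |f n' - f n| ≤ 2 * ‖f‖ := fun n' => by
    have h1 := f.norm_coe_le_norm n'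
    have h2 := f.norm_coe_le_norm n
    rw [Real.norm_eq_abs] at h1 h2
    exact (abs_sub _ _).trans (by linarith)
  have hψ := abs_psi_le_one α.2.1 (p.scale_nonneg β n) k
  have hl := (p.lam_pos k).le
  have hm := (p.mu_pos k).le
  have hb : (0 : ℝ) ≤ β := β.cast_nonneg
  refine (abs_add_le _ _).trans ?_
  rw [abs_mul, abs_mul, abs_mul, abs_mul, abs_mul, abs_of_nonneg hl, abs_of_nonneg hm,
    abs_of_nonneg hb]
  have e1 : β * p.lam k * |f (n + Pi.single k 1) - f n| ≤ β * p.lam k * (2 * ‖f‖) :=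
    mul_le_mul_of_nonneg_left (hd _) (by positivity)
  have e2 : β * p.mu k * |psi α (p.scale β n) k| * |f (n - Pi.single k 1) - f n|
      ≤ β * p.mu k * 1 * (2 * ‖f‖) := by
    gcongr
    exact hd _
  linarith

/-- The infinitesimal generator of the quasi-stationary process of classes `2, …, L`, with
transitions `n → n + eₖ` at rate `βλₖ` and `n → n - eₖ` at rate `βμₖ ψₖ(α, β⁻¹ a ⊙ n)`.
The rates are bounded, so that this is a bounded operator on the bounded functions. -/
noncomputable def generator (α : unitInterval) (β : ℕ) :
    ((Fin m → ℕ) →ᵇ ℝ) →L[ℝ] ((Fin m → ℕ) →ᵇ ℝ) :=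
  LinearMap.mkContinuous
    { toFun := fun f =>
        BoundedContinuousFunction.ofNormedAddCommGroupDiscrete (p.genFun α β f) _
          (p.abs_genFun_le α β f)
      map_add' := fun f g => by
        ext n
        simp only [genFun, BoundedContinuousFunction.coe_ofNormedAddCommGroupDiscrete,
          BoundedContinuousFunction.coe_add, Pi.add_apply, ← Finset.sum_add_distrib]
        exact Finset.sum_congr rfl fun k _ => by ring
      map_smul' := fun c f => by
        ext n
        simp only [genFun, BoundedContinuousFunction.coe_ofNormedAddCommGroupDiscrete,
          BoundedContinuousFunction.coe_smul, smul_eq_mul, RingHom.id_apply, Finset.mul_sum]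
        exact Finset.sum_congr rfl fun k _ => by ring }
    (∑ k, (2 * β * p.lam k + 2 * β * p.mu k))
    (fun f => by
      have hC : 0 ≤ ∑ k, (2 * (β : ℝ) * p.lam k + 2 * β * p.mu k) :=
        Finset.sum_nonneg fun k _ => by
          have hl := (p.lam_pos k).le
          have hm := (p.mu_pos k).le
          positivity
      exact (BoundedContinuousFunction.norm_le (mul_nonneg hC (norm_nonneg f))).2
        (p.abs_genFun_le α β f))

/-- The transition semigroup `f ↦ (n ↦ 𝔼ₙ f(N(t)))` of the Markov process with bounded
generator `Q`, namely `exp (t Q)`. -/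
noncomputable def semigroup (α : unitInterval) (β : ℕ) (t : ℝ) :
    ((Fin m → ℕ) →ᵇ ℝ) →L[ℝ] ((Fin m → ℕ) →ᵇ ℝ) :=
  expOp (t • p.generator α β)

/-- `ν` is a stationary distribution of the quasi-stationary process `N_{2:L,β}^α`. -/
def IsStationary (α : unitInterval) (β : ℕ) (ν : ProbabilityMeasure (Fin m → ℕ)) : Prop :=
  ∀ t : ℝ, 0 ≤ t → ∀ f : (Fin m → ℕ) →ᵇ ℝ,
    ∫ n, p.semigroup α β t f n ∂(ν : Measure (Fin m → ℕ)) = ∫ n, f n ∂(ν : Measure (Fin m → ℕ))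

/-- The law of `β⁻¹ a ⊙ N` when `N` has law `ν`. -/
noncomputable def scaledLaw (β : ℕ) (ν : ProbabilityMeasure (Fin m → ℕ)) :
    ProbabilityMeasure (Fin m → ℝ) :=
  ν.map (f := p.scale β) (measurable_of_countable _).aemeasurable

/-- `∫ ψ₀(α, x) π(dx)`; for `π` the law of the scaled process in equilibrium, this is the average
throughput of class `0`. -/
noncomputable def phiBar (α : unitInterval) (π : ProbabilityMeasure (Fin m → ℝ)) : ℝ :=
  ∫ x, psiZero α x ∂(π : Measure (Fin m → ℝ))

/-- `γₖ(α) = max (ρₖ, ρₖ / (1 - ρₖ) * min (α, min_{j < k} (1 - ρⱼ)))`, the minimum over the empty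
set being omitted. -/
noncomputable def gamma (α : unitInterval) (k : Fin m) : ℝ :=
  max (p.rho k)
    (p.rho k / (1 - p.rho k) * (Finset.Iio k).fold min (α : ℝ) (fun j => 1 - p.rho j))

/-- `min (α, min_k (1 - ρₖ))`, the minimum over the empty set being omitted. -/
noncomputable def phiLim (α : unitInterval) : ℝ :=
  Finset.univ.fold min (α : ℝ) (fun k => 1 - p.rho k)

end LinearNetwork

/-!
A single quadratic Lyapunov function per class drives the whole argument. Since
`tailDrop y z = y / max 1 (y + z)` for nonnegative rates, the output rate of a local class on its
link is Lipschitz, and the equation `tailDrop x t = ρ` has the explicit solution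
`max ρ (ρ / (1 - ρ) * t)` (`tailDrop_eq_iff`), in which case class `0` leaves the link at rate
`min t (1 - ρ)`. Solving link after link gives the fixed point `γ(α)` and the limit throughput.

Let `θₖ` denote the rate of class `0` at the input of the link of class `k`. The generator applied
to `(xₖ - γₖ)²` is at most
`C |θₖ(x) - θₖ(γ)| + C' / β - c (xₖ - γₖ)² / (1 + xₖ)`, with constants that do not depend on `α`
(`genFun_sq_scale_sub_gamma_le`). This has three consequences.

* As `|θₖ(x) - θₖ(γ)| ≤ 1`, Foster's criterion yields a stationary distribution. The criterion is
  proved for Markov operators on countable sets, by passing to the limit along an ultrafilter in the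
  Cesàro averages; the drift condition prevents loss of mass. Uniqueness follows from irreducibility
  by testing stationarity against the sign of the difference of two stationary distributions.
* Integrating the inequality against a stationary distribution, which is justified by truncating
  the Lyapunov function, bounds `𝔼 xₖ` uniformly in `α` and `β`, whence tightness.
* As `θₖ` is a Lipschitz function of the `xⱼ` with `j < k`, induction on `k` gives
  `𝔼 |xₖ - γₖ(α)| → 0` uniformly in `α`. This implies the weak convergence, and the convergence of
  the throughput of class `0` uniformly in `α`; the infimum over `u ≥ α` then converges too, because
  the limit throughput is monotone in `u`.

Stationarity, defined by the semigroup `exp (t Q)`, is used in the form `∫ Q f dν = 0`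
(`isStationary_iff`).
-/

open MeasureTheory Filter Topology
open scoped BoundedContinuousFunction

namespace LinearNetwork

variable {m : ℕ}

/-! ### Tail dropping -/

/-- The form of the tail dropping rate in which its continuity at the origin is visible. -/
lemma tailDrop_eq {y z : ℝ} (hy : 0 ≤ y) (hz : 0 ≤ z) : tailDrop y z = y / max 1 (y + z) := by
  unfold tailDrop
  rcases hy.eq_or_lt with rfl | hy'
  · simp
  have hs : 0 < y + z := by linarith
  rcases le_total 1 (y + z) with h | h
  · rw [max_eq_right h, min_eq_right (div_le_self hy h)]
  · rw [max_eq_left h, div_one, min_eq_left]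
    rw [le_div_iff₀ hs]
    nlinarith

lemma tailDrop_nonneg {y z : ℝ} (hy : 0 ≤ y) (hz : 0 ≤ z) : 0 ≤ tailDrop y z := by
  rw [tailDrop_eq hy hz]
  positivity

lemma tailDrop_le_one {y z : ℝ} (hy : 0 ≤ y) (hz : 0 ≤ z) : tailDrop y z ≤ 1 := by
  rw [tailDrop_eq hy hz]
  exact div_le_one_of_le₀ ((le_add_of_nonneg_right hz).trans (le_max_right _ _)) (by positivity)

lemma abs_max_one_sub_max_one_le (s t : ℝ) : |max 1 s - max 1 t| ≤ |s - t| := by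
  simpa using abs_max_sub_max_le_max 1 s 1 t

lemma abs_tailDrop_sub_le {y z y' z' : ℝ} (hy : 0 ≤ y) (hz : 0 ≤ z) (hy' : 0 ≤ y')
    (hz' : 0 ≤ z') : |tailDrop y z - tailDrop y' z'| ≤ 2 * |y - y'| + |z - z'| := by
  rw [tailDrop_eq hy hz, tailDrop_eq hy' hz']
  have hd := abs_max_one_sub_max_one_le (y' + z') (y + z)
  have hM : 1 ≤ max 1 (y + z) := le_max_left _ _
  have hM' : 1 ≤ max 1 (y' + z') := le_max_left _ _
  have hyM' : y' ≤ max 1 (y' + z') := (le_add_of_nonneg_right hz').trans (le_max_right _ _)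
  generalize max 1 (y + z) = M at *
  generalize max 1 (y' + z') = M' at *
  have hM0 : 0 < M := by linarith
  have hM0' : 0 < M' := by linarith
  have e : y / M - y' / M' = (y - y') / M + y' / M' * ((M' - M) / M) := by
    field_simp
    ring
  have h1 : |(y - y') / M| ≤ |y - y'| := by
    rw [abs_div, abs_of_pos hM0]
    exact div_le_self (abs_nonneg _) hM
  have h2 : |(M' - M) / M| ≤ |y' + z' - (y + z)| := by
    rw [abs_div, abs_of_pos hM0]
    exact (div_le_self (abs_nonneg _) hM).trans hd
  have h3 : |y' / M'| ≤ 1 := by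
    rw [abs_of_nonneg (by positivity)]
    exact div_le_one_of_le₀ hyM' hM0'.le
  have h4 : |y' / M' * ((M' - M) / M)| ≤ |y' + z' - (y + z)| := by
    rw [abs_mul]
    calc _ ≤ 1 * |(M' - M) / M| := by gcongr
      _ ≤ _ := by rwa [one_mul]
  have h5 : |y' + z' - (y + z)| ≤ |y - y'| + |z - z'| := by
    have : y' + z' - (y + z) = -((y - y') + (z - z')) := by ring
    rw [this, abs_neg]
    exact abs_add_le _ _
  rw [e]
  refine (abs_add_le _ _).trans ?_
  linarith

/-- The equilibrium of a single link: the output rate of the local class equals `r` for exactly one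
input rate. -/
lemma tailDrop_eq_iff {x t r : ℝ} (hx : 0 ≤ x) (ht : 0 ≤ t) (hr0 : 0 ≤ r) (hr : r < 1) :
    tailDrop x t = r ↔ x = max r (r / (1 - r) * t) := by
  have h1 : 0 < 1 - r := by linarith
  rw [tailDrop_eq hx ht, div_eq_iff (by positivity), div_mul_eq_mul_div]
  constructor
  · intro h
    rcases le_total 1 (x + t) with h' | h'
    · rw [max_eq_right h'] at h
      have e : r * t = x * (1 - r) := by linarith
      rw [e, mul_div_cancel_right₀ _ h1.ne', max_eq_right]
      nlinarith
    · rw [max_eq_left h', mul_one] at h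
      subst h
      rw [max_eq_left]
      rw [div_le_iff₀ h1]
      nlinarith
  · intro h
    rcases le_total (1 - r) t with h' | h'
    · have e : x = r * t / (1 - r) := by
        rw [h, max_eq_right]
        rw [le_div_iff₀ h1]
        nlinarith
      rw [eq_div_iff h1.ne'] at e
      rw [max_eq_right]
      · linarith
      · have : (x + t) * (1 - r) = t := by linear_combination e
        nlinarith
    · have e : x = r := by
        rw [h, max_eq_left]
        rw [div_le_iff₀ h1]
        nlinarith
      rw [e, max_eq_left (by linarith), mul_one]


/-- The output rate of the traffic crossing a single link in equilibrium. -/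
lemma tailDrop_swap_eq_min {x t r : ℝ} (hx : 0 ≤ x) (ht : 0 ≤ t) (h : tailDrop x t = r) :
    tailDrop t x = min t (1 - r) := by
  subst h
  have e : (1 : ℝ) - tailDrop x t = (max 1 (x + t) - x) / max 1 (x + t) := by
    rw [tailDrop_eq hx ht]
    field_simp
  rw [e, tailDrop_eq ht hx, add_comm t x]
  rcases le_total 1 (x + t) with h' | h'
  · rw [max_eq_right h', min_eq_right]
    · ring
    · rw [div_le_iff₀ (by linarith)]
      nlinarith
  · rw [max_eq_left h', div_one, div_one, min_eq_left (by linarith)]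

/-- Drift of the single-link dynamics towards its equilibrium `c`, when the rate `t` of the crossing
traffic is a perturbation of the rate `t'` for which `c` is the equilibrium. The perturbation term
stays bounded in `x` because the sensitivity of `tailDrop x t` to `t` decays like `1 / x`. -/
lemma sub_mul_tailDrop_sub_ge {x c t t' r : ℝ} (hx : 0 ≤ x) (hc : 0 ≤ c) (ht : 0 ≤ t)
    (ht' : 0 ≤ t') (ht'1 : t' ≤ 1) (hr0 : 0 ≤ r) (hr1 : r ≤ 1) (h : tailDrop c t' = r) :
    (1 - r) * ((x - c) ^ 2 / (1 + x)) - (1 + c) * |t - t'| ≤ (x - c) * (tailDrop x t - r) := by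
  rw [tailDrop_eq hc ht', div_eq_iff (by positivity)] at h
  have hd := abs_max_one_sub_max_one_le (x + t') (c + t')
  have hd' := abs_max_one_sub_max_one_le (x + t') (x + t)
  rw [tailDrop_eq hx ht]
  have hM : 1 ≤ max 1 (x + t) := le_max_left _ _
  have hMx : x ≤ max 1 (x + t) := (le_add_of_nonneg_right ht).trans (le_max_right _ _)
  have hM' : 1 ≤ max 1 (x + t') := le_max_left _ _
  have hMx' : x ≤ max 1 (x + t') := (le_add_of_nonneg_right ht').trans (le_max_right _ _)
  have hM'x : max 1 (x + t') ≤ 1 + x := max_le (by linarith) (by linarith)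
  generalize max 1 (x + t) = M at *
  generalize max 1 (x + t') = M' at *
  generalize max 1 (c + t') = K at *
  have hM0 : 0 < M := by linarith
  have hM0' : 0 < M' := by linarith
  -- the unperturbed drift, where `x / M' - r` has the sign of `x - c`
  have h1 : (1 - r) * ((x - c) ^ 2 / (1 + x)) ≤ (x - c) * (x / M' - r) := by
    have hk : (x - c) * (M' - K) ≤ (x - c) ^ 2 := by
      calc (x - c) * (M' - K) ≤ |(x - c) * (M' - K)| := le_abs_self _
        _ = |x - c| * |M' - K| := abs_mul _ _
        _ ≤ |x - c| * |x - c| := by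
          rw [add_sub_add_right_eq_sub] at hd
          exact mul_le_mul_of_nonneg_left hd (abs_nonneg _)
        _ = (x - c) ^ 2 := by rw [abs_mul_abs_self, sq]
    have e : (x - c) * (x / M' - r) = (x - c) * (x - r * M') / M' := by
      field_simp
    have hn : (1 - r) * (x - c) ^ 2 ≤ (x - c) * (x - r * M') := by
      have : (x - c) * (x - r * M') = (x - c) ^ 2 - r * ((x - c) * (M' - K)) := by
        linear_combination (x - c) * h
      rw [this]
      nlinarith
    rw [e, ← mul_div_assoc]
    have hn0 : 0 ≤ (1 - r) * (x - c) ^ 2 := mul_nonneg (by linarith) (sq_nonneg _)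
    calc _ ≤ (1 - r) * (x - c) ^ 2 / M' := by gcongr
      _ ≤ _ := by gcongr
  have h2 : |(x - c) * (x / M - x / M')| ≤ (1 + c) * |t - t'| := by
    have e : (x - c) * (x / M - x / M') = (x - c) / M * (x / M') * (M' - M) := by
      field_simp
    have a1 : |(x - c) / M| ≤ 1 + c := by
      rw [abs_div, abs_of_pos hM0, div_le_iff₀ hM0, abs_le]
      constructor <;> nlinarith
    have a2 : |x / M'| ≤ 1 := by
      rw [abs_of_nonneg (by positivity)]
      exact div_le_one_of_le₀ hMx' hM0'.le
    have a3 : |M' - M| ≤ |t - t'| := by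
      rw [abs_sub_comm t t']
      simpa using hd'
    rw [e, abs_mul, abs_mul]
    calc _ ≤ (1 + c) * 1 * |t - t'| := by gcongr
      _ = _ := by ring
  have h3 := (abs_le.1 h2).1
  have e : (x - c) * (x / M - r) = (x - c) * (x / M' - r) + (x - c) * (x / M - x / M') := by ring
  linarith

/-! ### Rates along the network and the fixed point -/

@[simp]
lemma theta_zero (α : ℝ) (x : Fin m → ℝ) : theta α x 0 = α := by simp [theta]

lemma theta_succ (α : ℝ) (x : Fin m → ℝ) (k : Fin m) :
    theta α x k.succ = tailDrop (theta α x k.castSucc) (x k) := by simp [theta]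

lemma theta_le_one {α : ℝ} (hα : α ≤ 1) (x : Fin m → ℝ) (i : Fin (m + 1)) :
    theta α x i ≤ 1 := by
  induction i using Fin.induction with
  | zero => simpa using hα
  | succ k ih =>
    rw [theta_succ]
    exact (min_le_left _ _).trans ih

lemma measurable_theta (α : ℝ) (i : Fin (m + 1)) :
    Measurable fun x : Fin m → ℝ => theta α x i := by
  induction i using Fin.induction with
  | zero => simp
  | succ k ih =>
    simp only [theta_succ, tailDrop]
    exact ih.min (ih.div (ih.add (measurable_pi_apply k)))

variable (p : LinearNetwork m)

lemma rho_pos (k : Fin m) : 0 < p.rho k := div_pos (p.lam_pos k) (p.mu_pos k)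

/-- If every local class is in equilibrium given the rate `min (α, min_{j < k} (1 - ρⱼ))` of class
`0` at its link, then these are indeed the rates of class `0`. -/
lemma theta_eq_fold (α : unitInterval) {x : Fin m → ℝ} (hx : ∀ k, 0 ≤ x k)
    (h : ∀ k, theta α x k.castSucc = (Finset.Iio k).fold min (α : ℝ) (fun j => 1 - p.rho j) →
      psi α x k = p.rho k) (i : Fin (m + 1)) :
    theta α x i =
      (Finset.univ.filter fun j : Fin m => j.castSucc < i).fold min (α : ℝ)
        (fun j => 1 - p.rho j) := by
  induction i using Fin.induction with
  | zero => simp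
  | succ k ih =>
    have e : (Finset.univ.filter fun j : Fin m => j.castSucc < k.castSucc) = Finset.Iio k := by
      ext j
      simp
    have e' : (Finset.univ.filter fun j : Fin m => j.castSucc < k.succ)
        = insert k (Finset.Iio k) := by
      ext j
      simp [Fin.castSucc_lt_succ_iff, le_iff_eq_or_lt]
    rw [e] at ih
    have ht := theta_nonneg α.2.1 hx k.castSucc
    rw [theta_succ, tailDrop_swap_eq_min (hx k) ht (h k ih), e', Finset.fold_insert (by simp),
      ← ih, min_comm]

lemma theta_castSucc_eq_fold (α : unitInterval) {x : Fin m → ℝ} (hx : ∀ k, 0 ≤ x k)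
    (h : ∀ k, theta α x k.castSucc = (Finset.Iio k).fold min (α : ℝ) (fun j => 1 - p.rho j) →
      psi α x k = p.rho k) (k : Fin m) :
    theta α x k.castSucc = (Finset.Iio k).fold min (α : ℝ) (fun j => 1 - p.rho j) := by
  rw [p.theta_eq_fold α hx h]
  congr 1
  ext j
  simp

lemma gamma_nonneg (α : unitInterval) (k : Fin m) : 0 ≤ p.gamma α k :=
  (p.rho_pos k).le.trans (le_max_left _ _)

lemma gamma_le (hρ : ∀ k, p.rho k < 1) (α : unitInterval) (k : Fin m) :
    p.gamma α k ≤ p.rho k / (1 - p.rho k) := by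
  have h0 := p.rho_pos k
  have h1 : 0 < 1 - p.rho k := by linarith [hρ k]
  refine max_le ?_ ?_
  · rw [le_div_iff₀ h1]
    nlinarith
  · refine mul_le_of_le_one_right (by positivity) ?_
    exact (Finset.fold_min_le _).2 (Or.inl α.2.2)

lemma psi_eq_rho_iff (hρ : ∀ k, p.rho k < 1) (α : unitInterval) {x : Fin m → ℝ}
    (hx : ∀ k, 0 ≤ x k) {k : Fin m}
    (h : theta α x k.castSucc = (Finset.Iio k).fold min (α : ℝ) (fun j => 1 - p.rho j)) :
    psi α x k = p.rho k ↔ x k = p.gamma α k := by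
  unfold psi gamma
  rw [← h]
  exact tailDrop_eq_iff (hx k) (theta_nonneg α.2.1 hx _) (p.rho_pos k).le (hρ k)

lemma psi_gamma (hρ : ∀ k, p.rho k < 1) (α : unitInterval) (k : Fin m) :
    psi α (p.gamma α) k = p.rho k := by
  have h := p.theta_castSucc_eq_fold α (p.gamma_nonneg α)
    (fun k h => (p.psi_eq_rho_iff hρ α (p.gamma_nonneg α) h).2 rfl) k
  exact (p.psi_eq_rho_iff hρ α (p.gamma_nonneg α) h).2 rfl

lemma psiZero_gamma (hρ : ∀ k, p.rho k < 1) (α : unitInterval) :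
    psiZero α (p.gamma α) = p.phiLim α := by
  unfold psiZero phiLim
  rw [p.theta_eq_fold α (p.gamma_nonneg α) fun k _ => p.psi_gamma hρ α k]
  congr 1
  ext j
  simp [Fin.castSucc_lt_last]

lemma eq_gamma_iff (hρ : ∀ k, p.rho k < 1) (α : unitInterval) {x : Fin m → ℝ}
    (hx : ∀ k, 0 ≤ x k) :
    (∀ k, p.lam k - p.mu k * psi α x k = 0) ↔ x = p.gamma α := by
  have e : ∀ k, p.lam k - p.mu k * psi α x k = 0 ↔ psi α x k = p.rho k := fun k => by
    rw [rho, eq_div_iff (p.mu_pos k).ne', sub_eq_zero, eq_comm, mul_comm]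
  simp only [e]
  constructor
  · intro h
    funext k
    exact (p.psi_eq_rho_iff hρ α hx (p.theta_castSucc_eq_fold α hx (fun k _ => h k) k)).1 (h k)
  · rintro rfl
    exact p.psi_gamma hρ α

lemma phiLim_mono {α α' : unitInterval} (h : α ≤ α') : p.phiLim α ≤ p.phiLim α' := by
  unfold phiLim
  rw [Finset.le_fold_min]
  refine ⟨(Finset.fold_min_le _).2 (Or.inl h), fun k hk => ?_⟩
  exact (Finset.fold_min_le _).2 (Or.inr ⟨k, hk, le_rfl⟩)

/-! ### Stationarity in terms of the generator -/

lemma generator_apply (α : unitInterval) (β : ℕ) (f : (Fin m → ℕ) →ᵇ ℝ) (n : Fin m → ℕ) :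
    p.generator α β f n = p.genFun α β f n := rfl

/-- Integration of bounded continuous functions against a probability measure, as a continuous
linear functional. -/
noncomputable def integralFunctional {S : Type*} [MeasurableSpace S] [TopologicalSpace S]
    [OpensMeasurableSpace S] (ν : Measure S) [IsProbabilityMeasure ν] : (S →ᵇ ℝ) →L[ℝ] ℝ :=
  LinearMap.mkContinuous
    { toFun := fun f => ∫ s, f s ∂ν
      map_add' := fun f g => integral_add (f.integrable ν) (g.integrable ν)
      map_smul' := fun c f => integral_const_mul c f }
    1 (fun f => by simpa using f.norm_integral_le_norm ν)

lemma integralFunctional_apply {S : Type*} [MeasurableSpace S] [TopologicalSpace S]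
    [OpensMeasurableSpace S] (ν : Measure S) [IsProbabilityMeasure ν] (f : S →ᵇ ℝ) :
    integralFunctional ν f = ∫ s, f s ∂ν := rfl

lemma hasDerivAt_integral_semigroup (α : unitInterval) (β : ℕ)
    (ν : ProbabilityMeasure (Fin m → ℕ)) (f : (Fin m → ℕ) →ᵇ ℝ) (t : ℝ) :
    HasDerivAt (fun t => ∫ n, p.semigroup α β t f n ∂(ν : Measure (Fin m → ℕ)))
      (∫ n, p.genFun α β (p.semigroup α β t f) n ∂(ν : Measure (Fin m → ℕ))) t := by
  have h := hasDerivAt_exp_smul_const' (𝕂 := ℝ) (p.generator α β) t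
  have h1 := h.clm_apply (hasDerivAt_const t f)
  have h2 := (integralFunctional (ν : Measure (Fin m → ℕ))).hasFDerivAt.comp_hasDerivAt t h1
  simpa [Function.comp_def, integralFunctional_apply, generator_apply, semigroup, expOp] using h2

lemma isStationary_iff (α : unitInterval) (β : ℕ) (ν : ProbabilityMeasure (Fin m → ℕ)) :
    p.IsStationary α β ν ↔
      ∀ f : (Fin m → ℕ) →ᵇ ℝ, ∫ n, p.genFun α β f n ∂(ν : Measure (Fin m → ℕ)) = 0 := by
  have h0 : ∀ f, p.semigroup α β 0 f = f := fun f => by simp [semigroup, expOp]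
  constructor
  · intro h f
    have h1 := (p.hasDerivAt_integral_semigroup α β ν f 0).hasDerivWithinAt (s := Set.Ici 0)
    have h2 : HasDerivWithinAt
        (fun t => ∫ n, p.semigroup α β t f n ∂(ν : Measure (Fin m → ℕ))) 0 (Set.Ici 0) 0 :=
      (hasDerivWithinAt_const (0 : ℝ) (Set.Ici 0) _).congr (fun t ht => h t ht f)
        (h 0 le_rfl f)
    have := (uniqueDiffWithinAt_Ici (0 : ℝ)).eq_deriv _ h1 h2
    rwa [h0] at this
  · intro h t _ f
    have hd := fun t => p.hasDerivAt_integral_semigroup α β ν f t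
    have := is_const_of_deriv_eq_zero (fun t => (hd t).differentiableAt)
      (fun t => by rw [(hd t).deriv, h]) t 0
    simpa [h0] using this

/-! ### Transition rates and irreducibility -/

lemma psi_nonneg {α : ℝ} (hα : 0 ≤ α) {x : Fin m → ℝ} (hx : ∀ k, 0 ≤ x k) (k : Fin m) :
    0 ≤ psi α x k := tailDrop_nonneg (hx k) (theta_nonneg hα hx _)

lemma psi_le_one {α : ℝ} (hα : 0 ≤ α) {x : Fin m → ℝ} (hx : ∀ k, 0 ≤ x k) (k : Fin m) :
    psi α x k ≤ 1 := tailDrop_le_one (hx k) (theta_nonneg hα hx _)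

lemma psi_pos {α : ℝ} (hα : 0 ≤ α) {x : Fin m → ℝ} (hx : ∀ k, 0 ≤ x k) {k : Fin m}
    (hk : 0 < x k) : 0 < psi α x k := by
  unfold psi
  rw [tailDrop_eq (hx k) (theta_nonneg hα hx _)]
  positivity

lemma psi_eq_zero (α : ℝ) {x : Fin m → ℝ} {k : Fin m} (hk : x k = 0) : psi α x k = 0 := by
  simp [psi, tailDrop, hk]

lemma birthRate_nonneg (β : ℕ) (k : Fin m) : 0 ≤ β * p.lam k :=
  mul_nonneg β.cast_nonneg (p.lam_pos k).le

lemma deathRate_nonneg (α : unitInterval) (β : ℕ) (n : Fin m → ℕ) (k : Fin m) :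
    0 ≤ β * p.mu k * psi α (p.scale β n) k :=
  mul_nonneg (mul_nonneg β.cast_nonneg (p.mu_pos k).le)
    (psi_nonneg α.2.1 (p.scale_nonneg β n) k)

lemma scale_pos {β : ℕ} (hβ : 1 ≤ β) {n : Fin m → ℕ} {k : Fin m} (hn : 0 < n k) :
    0 < p.scale β n k := by
  have h1 : (0 : ℝ) < β := by exact_mod_cast hβ
  have h2 : (0 : ℝ) < n k := by exact_mod_cast hn
  have := p.a_pos k
  unfold scale
  positivity

/-- The lattice `ℕ^m` is connected by steps along the coordinate directions. -/
lemma iff_zero_of_iff_add_single {P : (Fin m → ℕ) → Prop}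
    (h : ∀ n k, P n ↔ P (n + Pi.single k 1)) (n : Fin m → ℕ) : P n ↔ P 0 := by
  induction hs : ∑ k, n k generalizing n with
  | zero =>
    have : n = 0 := by
      funext k
      simpa using (Finset.sum_eq_zero_iff.1 hs) k (Finset.mem_univ k)
    rw [this]
  | succ s ih =>
    obtain ⟨k, -, hk⟩ : ∃ k ∈ Finset.univ, n k ≠ 0 := by
      by_contra! h0
      rw [Finset.sum_eq_zero h0] at hs
      omega
    have hle : (Pi.single k 1 : Fin m → ℕ) ≤ n := by
      intro j
      by_cases hj : j = k
      · subst hj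
        simpa using Nat.one_le_iff_ne_zero.2 hk
      · simp [hj]
    have e : n - Pi.single k 1 + Pi.single k 1 = n := tsub_add_cancel_of_le hle
    have hsum : ∑ j, (n - Pi.single k 1 : Fin m → ℕ) j = s := by
      have := congrArg (fun f : Fin m → ℕ => ∑ j, f j) e
      simp only [Pi.add_apply, Finset.sum_add_distrib, Finset.sum_pi_single', Finset.mem_univ,
        if_true] at this
      omega
    rw [← ih _ hsum, h (n - Pi.single k 1) k, e]

/-! ### Uniqueness of the stationary distribution -/

lemma hasSum_real_mul_integral {S : Type*} [MeasurableSpace S] [MeasurableSingletonClass S]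
    [Countable S] {ν : Measure S} {f : S → ℝ} (hf : Integrable f ν) :
    HasSum (fun s => ν.real {s} * f s) (∫ s, f s ∂ν) := by
  have hf' := hf
  rw [← Measure.sum_smul_dirac ν] at hf'
  have := hasSum_integral_measure hf'
  simpa only [integral_smul_measure, integral_dirac, Measure.sum_smul_dirac, measureReal_def,
    smul_eq_mul] using this

/-- The sign `s` of the difference `w = ν₁ - ν₂` of two stationary distributions satisfies
`w(n) (s(n') - s(n)) ≤ 0` for every transition `n → n'`, while these terms, weighted with the
transition rates, sum to `∫ Q s dν₁ - ∫ Q s dν₂ = 0`. Hence they vanish, and by irreducibility `w`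
has constant sign. -/
lemma IsStationary.unique {α : unitInterval} {β : ℕ} (hβ : 1 ≤ β)
    {ν₁ ν₂ : ProbabilityMeasure (Fin m → ℕ)} (h₁ : p.IsStationary α β ν₁)
    (h₂ : p.IsStationary α β ν₂) : ν₁ = ν₂ := by
  set w : (Fin m → ℕ) → ℝ := fun n =>
    (ν₁ : Measure (Fin m → ℕ)).real {n} - (ν₂ : Measure (Fin m → ℕ)).real {n} with hw
  have hsign : ∀ y : ℝ, ‖(SignType.sign y : ℝ)‖ ≤ 1 := fun y => by
    rcases lt_trichotomy y 0 with hy | hy | hy <;> simp [hy]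
  let s : (Fin m → ℕ) →ᵇ ℝ := BoundedContinuousFunction.ofNormedAddCommGroupDiscrete
    (fun n => (SignType.sign (w n) : ℝ)) 1 (fun n => hsign _)
  have hs : ∀ n, s n = SignType.sign (w n) := fun n => rfl
  have key : ∀ n n', w n * (s n' - s n) ≤ 0 := fun n n' => by
    have e : w n * s n = |w n| := by rw [hs, self_mul_sign]
    have e' : w n * s n' ≤ |w n| := by
      refine (le_abs_self _).trans ?_
      rw [abs_mul]
      exact mul_le_of_le_one_right (abs_nonneg _) (hsign _)
    rw [mul_sub]
    linarith
  have hgen : HasSum (fun n => w n * p.genFun α β s n) 0 := by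
    have e₁ := hasSum_real_mul_integral
      ((p.generator α β s).integrable (ν₁ : Measure (Fin m → ℕ)))
    have e₂ := hasSum_real_mul_integral
      ((p.generator α β s).integrable (ν₂ : Measure (Fin m → ℕ)))
    simp only [generator_apply] at e₁ e₂
    rw [(p.isStationary_iff α β ν₁).1 h₁] at e₁
    rw [(p.isStationary_iff α β ν₂).1 h₂] at e₂
    simpa only [hw, sub_mul, sub_zero] using e₁.sub e₂
  have hexp : ∀ n, w n * p.genFun α β s n
      = ∑ k, (β * p.lam k * (w n * (s (n + Pi.single k 1) - s n))
        + β * p.mu k * psi α (p.scale β n) k * (w n * (s (n - Pi.single k 1) - s n))) := fun n => by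
    rw [genFun, Finset.mul_sum]
    exact Finset.sum_congr rfl fun k _ => by ring
  have hb : ∀ n k, β * p.lam k * (w n * (s (n + Pi.single k 1) - s n)) ≤ 0 := fun n k =>
    mul_nonpos_of_nonneg_of_nonpos (p.birthRate_nonneg β k) (key _ _)
  have hd : ∀ n k, β * p.mu k * psi α (p.scale β n) k * (w n * (s (n - Pi.single k 1) - s n)) ≤ 0 :=
    fun n k => mul_nonpos_of_nonneg_of_nonpos (p.deathRate_nonneg α β n k) (key _ _)
  have hterm : ∀ n, w n * p.genFun α β s n = 0 := by
    have := (hasSum_zero_iff_of_nonneg (f := fun n => -(w n * p.genFun α β s n)) fun n => by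
      simp only [hexp, neg_nonneg]
      exact Finset.sum_nonpos fun k _ => add_nonpos (hb n k) (hd n k)).1 (by simpa using hgen.neg)
    intro n
    simpa using congrFun this n
  have hzero : ∀ n k, β * p.lam k * (w n * (s (n + Pi.single k 1) - s n)) = 0 ∧
      β * p.mu k * psi α (p.scale β n) k * (w n * (s (n - Pi.single k 1) - s n)) = 0 := by
    intro n k
    have h := hterm n
    rw [hexp, Finset.sum_eq_zero_iff_of_nonpos fun k _ => add_nonpos (hb n k) (hd n k)] at h
    have := h k (Finset.mem_univ k)
    constructor <;> linarith [hb n k, hd n k]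
  have hβ0 : (0 : ℝ) < β := by exact_mod_cast hβ
  have hpos : ∀ n n', w n * (s n' - s n) = 0 → 0 < w n → 0 < w n' := by
    intro n n' h hn
    have : s n' = s n := by
      rcases mul_eq_zero.1 h with h | h <;> linarith
    rw [hs, hs, sign_pos hn] at this
    by_contra! hle
    rcases hle.lt_or_eq with h' | h'
    · rw [sign_neg h'] at this
      norm_num at this
    · rw [h', sign_zero] at this
      norm_num at this
  have hiff : ∀ n k, 0 < w n ↔ 0 < w (n + Pi.single k 1) := by
    intro n k
    constructor
    · refine hpos _ _ ((mul_eq_zero.1 (hzero n k).1).resolve_left ?_)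
      have := p.lam_pos k
      positivity
    · refine hpos _ _ ?_
      have h := (mul_eq_zero.1 (hzero (n + Pi.single k 1) k).2).resolve_left ?_
      · rwa [add_tsub_cancel_right] at h
      · have h1 := p.mu_pos k
        have h2 := psi_pos α.2.1 (p.scale_nonneg β (n + Pi.single k 1))
          (p.scale_pos hβ (k := k) (by simp))
        positivity
  have hall := iff_zero_of_iff_add_single hiff
  have hsum : HasSum w 0 := by
    have e₁ := hasSum_real_mul_integral (integrable_const (μ := (ν₁ : Measure (Fin m → ℕ))) (1 : ℝ))
    have e₂ := hasSum_real_mul_integral (integrable_const (μ := (ν₂ : Measure (Fin m → ℕ))) (1 : ℝ))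
    simpa only [mul_one, integral_const, probReal_univ, smul_eq_mul, sub_self] using e₁.sub e₂
  have hw0 : w = 0 := by
    by_cases h0 : 0 < w 0
    · exact (hasSum_zero_iff_of_nonneg fun n => ((hall n).2 h0).le).1 hsum
    · have := (hasSum_zero_iff_of_nonneg (f := fun n => -w n) fun n => by
        simpa using mt (hall n).1 h0).1 (by simpa using hsum.neg)
      funext n
      simpa using congrFun this n
  apply Subtype.ext
  refine Measure.ext_of_singleton fun n => ?_
  exact (measureReal_eq_measureReal_iff (measure_ne_top (ν₁ : Measure (Fin m → ℕ)) _)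
    (measure_ne_top (ν₂ : Measure (Fin m → ℕ)) _)).1 (sub_eq_zero.1 (congrFun hw0 n))

/-! ### Existence of invariant distributions from a drift condition -/

lemma abs_apply_le_of_abs_le {S : Type*} {A : (S → ℝ) →ₗ[ℝ] ℝ} (hpos : ∀ f, 0 ≤ f → 0 ≤ A f)
    {f g : S → ℝ} (h : ∀ s, |f s| ≤ g s) : |A f| ≤ A g := by
  have h1 := hpos (g - f) fun s => sub_nonneg.2 ((le_abs_self _).trans (h s))
  have h2 := hpos (g + f) fun s => by
    have := neg_le_of_abs_le (h s)
    simp only [Pi.zero_apply, Pi.add_apply]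
    linarith
  rw [map_sub] at h1
  rw [map_add] at h2
  exact abs_le.2 ⟨by linarith, by linarith⟩

/-- Compactness of a tight sequence of normalized positive functionals on a countable set. Tightness
is expressed by a bound on the values of the functionals at a function `G` with finite sublevel
sets; it is what makes the limit countably additive. -/
lemma exists_tendsto_integral_of_tight {S : Type*} [Countable S] [MeasurableSpace S]
    [MeasurableSingletonClass S] {A : ℕ → (S → ℝ) →ₗ[ℝ] ℝ}
    (hpos : ∀ N f, 0 ≤ f → 0 ≤ A N f) (hone : ∀ N, A N 1 = 1) {G : S → ℝ} {B : ℝ} (hG : 0 ≤ G)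
    (hfin : ∀ R, {s | G s ≤ R}.Finite) (hB : ∀ N, A N G ≤ B) :
    ∃ ν : Measure S, IsProbabilityMeasure ν ∧ ∀ f : S → ℝ, (∃ K, ∀ s, |f s| ≤ K) →
      Tendsto (fun N => A N f) (hyperfilter ℕ) (𝓝 (∫ s, f s ∂ν)) := by
  classical
  have hbd : ∀ N (f : S → ℝ) K, (∀ s, |f s| ≤ K) → |A N f| ≤ K := fun N f K h => by
    have := abs_apply_le_of_abs_le (g := K • (1 : S → ℝ)) (hpos N) (f := f) (by simpa using h)
    rwa [map_smul, hone, smul_eq_mul, mul_one] at this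
  have hlim : ∀ f : S → ℝ, (∃ K, ∀ s, |f s| ≤ K) →
      ∃ l, Tendsto (fun N => A N f) (hyperfilter ℕ) (𝓝 l) := by
    rintro f ⟨K, hK⟩
    obtain ⟨l, -, hl⟩ := (isCompact_Icc (a := -K) (b := K)).ultrafilter_le_nhds
      ((hyperfilter ℕ).map fun N => A N f)
      (by
        rw [le_principal_iff]
        exact Eventually.of_forall (f := (hyperfilter ℕ : Filter ℕ)) fun N =>
          abs_le.1 (hbd N f K hK))
    exact ⟨l, hl⟩
  choose! Λ hΛ using hlim
  set w : S → ℝ := fun s => Λ (Pi.single s 1) with hw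
  have hsingle : ∀ s : S, ∃ K, ∀ t, |(Pi.single s 1 : S → ℝ) t| ≤ K := fun s =>
    ⟨1, fun t => by
      rw [Pi.single_apply]
      split_ifs <;> simp⟩
  have hw0 : ∀ s, 0 ≤ w s := fun s => ge_of_tendsto' (hΛ _ (hsingle s)) fun N =>
    hpos N _ (Pi.single_nonneg.2 zero_le_one)
  have hB0 : 0 ≤ B := (hpos 0 G hG).trans (hB 0)
  have hsum : ∀ f : S → ℝ, (∃ K, ∀ s, |f s| ≤ K) → HasSum (fun s => w s * f s) (Λ f) := by
    rintro f ⟨K, hK⟩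
    rw [HasSum, SummationFilter.unconditional_filter, Metric.tendsto_atTop]
    intro ε hε
    have hK0 : 0 ≤ K := by
      by_contra! h
      have : IsEmpty S := ⟨fun s => absurd (hK s) (not_le.2 (h.trans_le (abs_nonneg _)))⟩
      have : (1 : S → ℝ) = 0 := Subsingleton.elim _ _
      have h1 := hone 0
      rw [this, map_zero] at h1
      exact zero_ne_one h1
    -- the threshold `R` is such that the part of `f` where `G > R` contributes less than `ε`
    set R : ℝ := K * B / ε + 1 with hR
    have hR0 : 0 < R := by positivity
    have hRε : K / R * B < ε := by
      rw [div_mul_eq_mul_div, div_lt_iff₀ hR0, hR, mul_add, mul_div_cancel₀ _ hε.ne']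
      linarith
    refine ⟨(hfin R).toFinset, fun F hF => ?_⟩
    set q : S → ℝ := ∑ s ∈ F, f s • Pi.single s 1 with hq
    have hqt : ∀ t, q t = if t ∈ F then f t else 0 := fun t => by
      simp [hq, Finset.sum_apply, Pi.single_apply]
    have h1 : Tendsto (fun N => A N q) (hyperfilter ℕ) (𝓝 (∑ s ∈ F, w s * f s)) := by
      simp only [hq, map_sum, map_smul, smul_eq_mul, mul_comm (w _)]
      exact tendsto_finsetSum _ fun s _ => (hΛ _ (hsingle s)).const_mul _
    have h2 : Tendsto (fun N => |A N q - A N f|) (hyperfilter ℕ)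
        (𝓝 |∑ s ∈ F, w s * f s - Λ f|) := (h1.sub (hΛ f ⟨K, hK⟩)).abs
    refine lt_of_le_of_lt (le_of_tendsto' h2 fun N => ?_) hRε
    rw [← map_sub]
    refine (abs_apply_le_of_abs_le (g := (K / R) • G) (hpos N) fun s => ?_).trans ?_
    · rw [Pi.sub_apply, hqt, Pi.smul_apply, smul_eq_mul]
      have hGs : 0 ≤ G s := hG s
      split_ifs with hs
      · rw [sub_self, abs_zero]
        positivity
      · have : R < G s := by
          by_contra! h
          exact hs (hF (by simpa using h))
        rw [zero_sub, abs_neg]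
        calc |f s| ≤ K := hK s
          _ = K / R * R := by field_simp
          _ ≤ K / R * G s := by gcongr
    · rw [map_smul, smul_eq_mul]
      have := hB N
      gcongr
  have hsum1 : HasSum w 1 := by
    have hone' : ∃ K, ∀ s, |(1 : S → ℝ) s| ≤ K := ⟨1, fun s => by simp⟩
    have h1 := hsum 1 hone'
    have h2 : Λ 1 = 1 := tendsto_nhds_unique (hΛ 1 hone') (by simp [hone])
    simpa [h2] using h1
  let μ : PMF S := ⟨fun s => ENNReal.ofReal (w s), by
    rw [ENNReal.summable.hasSum_iff, ← ENNReal.ofReal_tsum_of_nonneg hw0 hsum1.summable,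
      hsum1.tsum_eq, ENNReal.ofReal_one]⟩
  refine ⟨μ.toMeasure, inferInstance, fun f hf => ?_⟩
  have hμ : ∀ s, μ.toMeasure.real {s} = w s := fun s => by
    rw [measureReal_def, PMF.toMeasure_apply_singleton _ _ (measurableSet_singleton s)]
    exact ENNReal.toReal_ofReal (hw0 s)
  obtain ⟨K, hK⟩ := id hf
  have h1 := hasSum_real_mul_integral (Integrable.of_bound (μ := μ.toMeasure)
    (Measurable.of_discrete (f := f)).aestronglyMeasurable K (Eventually.of_forall hK))
  simp only [hμ] at h1
  rw [h1.unique (hsum f hf)]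
  exact hΛ f hf

/-- Foster's criterion: a Markov operator `P` on a countable set with a Lyapunov function `V` has an
invariant distribution, obtained as a limit of the Cesàro averages of the iterates of `P`. -/
lemma exists_invariant_of_drift {S : Type*} [Countable S] [Nonempty S] [MeasurableSpace S]
    [MeasurableSingletonClass S] (P : (S → ℝ) →ₗ[ℝ] (S → ℝ)) (hpos : ∀ f, 0 ≤ f → 0 ≤ P f)
    (hone : P 1 = 1) {V G : S → ℝ} {b : ℝ} (hV : 0 ≤ V) (hG : 0 ≤ G)
    (hfin : ∀ R, {s | G s ≤ R}.Finite) (hdrift : ∀ s, P V s ≤ V s + b - G s) :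
    ∃ ν : Measure S, IsProbabilityMeasure ν ∧ ∀ f : S → ℝ, (∃ K, ∀ s, |f s| ≤ K) →
      ∫ s, (P f - f) s ∂ν = 0 := by
  obtain ⟨s₀⟩ := ‹Nonempty S›
  have hpow : ∀ (j : ℕ) f, 0 ≤ f → 0 ≤ (P ^ j) f := fun j => by
    induction j with
    | zero => simp
    | succ j ih =>
      intro f hf
      rw [pow_succ', Module.End.mul_apply]
      exact hpos _ (ih f hf)
  have hpow1 : ∀ j : ℕ, (P ^ j) 1 = 1 := fun j => by
    induction j with
    | zero => simp
    | succ j ih => rw [pow_succ', Module.End.mul_apply, ih, hone]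
  let A : ℕ → (S → ℝ) →ₗ[ℝ] ℝ := fun N =>
    ((N + 1 : ℝ)⁻¹) • ∑ j ∈ Finset.range (N + 1), (LinearMap.proj s₀).comp (P ^ j)
  have hA : ∀ N f, A N f = (N + 1 : ℝ)⁻¹ * ∑ j ∈ Finset.range (N + 1), (P ^ j) f s₀ :=
    fun N f => by simp [A]
  have hN : ∀ N : ℕ, (0 : ℝ) < N + 1 := fun N => by positivity
  -- the drift condition telescopes along the iterates, and bounds the averages of `G`
  have hb : ∀ j : ℕ, (P ^ (j + 1)) V s₀ ≤ (P ^ j) V s₀ + b - (P ^ j) G s₀ := fun j => by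
    have := hpow j (V + b • 1 - G - P V) (fun s => by
      have := hdrift s
      simp only [Pi.zero_apply, Pi.sub_apply, Pi.add_apply, Pi.smul_apply, Pi.one_apply,
        smul_eq_mul]
      linarith) s₀
    rw [map_sub, map_sub, map_add, map_smul, hpow1] at this
    simp only [Pi.zero_apply, Pi.sub_apply, Pi.add_apply, Pi.smul_apply, Pi.one_apply,
      smul_eq_mul, mul_one] at this
    rw [pow_succ, Module.End.mul_apply]
    linarith
  have hsum : ∀ N : ℕ, ∑ j ∈ Finset.range N, (P ^ j) G s₀ ≤ N * b + V s₀ - (P ^ N) V s₀ :=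
    fun N => by
    induction N with
    | zero => simp
    | succ N ih =>
      rw [Finset.sum_range_succ]
      push_cast
      linarith [hb N]
  have hApos : ∀ N f, 0 ≤ f → 0 ≤ A N f := fun N f hf => by
    rw [hA]
    exact mul_nonneg (inv_nonneg.2 (hN N).le) (Finset.sum_nonneg fun j _ => hpow j f hf s₀)
  have hAone : ∀ N, A N 1 = 1 := fun N => by
    rw [hA]
    simp only [hpow1, Pi.one_apply, Finset.sum_const, Finset.card_range, nsmul_eq_mul, mul_one]
    push_cast
    exact inv_mul_cancel₀ (hN N).ne'
  have hAG : ∀ N, A N G ≤ b + V s₀ := fun N => by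
    rw [hA, inv_mul_le_iff₀ (hN N)]
    have h1 := hsum (N + 1)
    have h2 : 0 ≤ (P ^ (N + 1)) V s₀ := hpow (N + 1) V hV s₀
    have h3 : 0 ≤ (N : ℝ) * V s₀ := mul_nonneg N.cast_nonneg (hV s₀)
    push_cast at h1
    linarith
  obtain ⟨ν, hν, hlim⟩ := exists_tendsto_integral_of_tight hApos hAone hG hfin hAG
  refine ⟨ν, hν, ?_⟩
  rintro f ⟨K, hK⟩
  have hbd : ∀ (j : ℕ) s, |(P ^ j) f s| ≤ K := fun j s => by
    have := abs_apply_le_of_abs_le (A := (LinearMap.proj s).comp (P ^ j))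
      (g := K • (1 : S → ℝ)) (f := f) (fun f hf => hpow j f hf s) (by simpa using hK)
    simpa [hpow1] using this
  have h1 : Tendsto (fun N => A N (P f - f)) (hyperfilter ℕ) (𝓝 (∫ s, (P f - f) s ∂ν)) := by
    refine hlim _ ⟨K + K, fun s => ?_⟩
    have h0 := hbd 0 s
    have h1 := hbd 1 s
    rw [pow_zero, Module.End.one_apply] at h0
    rw [pow_one] at h1
    exact (abs_sub _ _).trans (add_le_add h1 h0)
  have h2 : ∀ N, A N (P f - f) = (N + 1 : ℝ)⁻¹ * ((P ^ (N + 1)) f s₀ - f s₀) := fun N => by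
    rw [hA]
    have : ∀ j : ℕ, (P ^ j) (P f - f) s₀ = (P ^ (j + 1)) f s₀ - (P ^ j) f s₀ := fun j => by
      rw [map_sub, pow_succ, Module.End.mul_apply, Pi.sub_apply]
    simp only [this]
    rw [Finset.sum_range_sub (fun j => (P ^ j) f s₀), pow_zero, Module.End.one_apply]
  have h3 : Tendsto (fun N => A N (P f - f)) atTop (𝓝 0) := by
    have hz : Tendsto (fun N : ℕ => (N + 1 : ℝ)⁻¹ * (K + K)) atTop (𝓝 0) := by
      have := (tendsto_one_div_add_atTop_nhds_zero_nat (𝕜 := ℝ)).mul_const (K + K)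
      simpa using this
    refine squeeze_zero_norm (fun N => ?_) hz
    rw [h2, Real.norm_eq_abs, abs_mul, abs_of_pos (inv_pos.2 (hN N))]
    refine mul_le_mul_of_nonneg_left ?_ (inv_nonneg.2 (hN N).le)
    exact (abs_sub _ _).trans (add_le_add (hbd _ _) (hK _))
  exact tendsto_nhds_unique h1 (h3.mono_left Nat.hyperfilter_le_atTop)

lemma genFun_add (α : unitInterval) (β : ℕ) (f g : (Fin m → ℕ) → ℝ) :
    p.genFun α β (f + g) = p.genFun α β f + p.genFun α β g := by
  funext n
  simp only [genFun, Pi.add_apply, ← Finset.sum_add_distrib]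
  exact Finset.sum_congr rfl fun k _ => by ring

lemma genFun_smul (α : unitInterval) (β : ℕ) (c : ℝ) (f : (Fin m → ℕ) → ℝ) :
    p.genFun α β (c • f) = c • p.genFun α β f := by
  funext n
  simp only [genFun, Pi.smul_apply, smul_eq_mul, Finset.mul_sum]
  exact Finset.sum_congr rfl fun k _ => by ring

lemma genFun_sum {ι : Type*} (s : Finset ι) (α : unitInterval) (β : ℕ)
    (f : ι → (Fin m → ℕ) → ℝ) :
    p.genFun α β (∑ i ∈ s, f i) = ∑ i ∈ s, p.genFun α β (f i) :=
  map_sum (AddMonoidHom.mk' (p.genFun α β) (p.genFun_add α β)) f s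

/-- The drift criterion for the continuous-time process, which has the same stationary distributions
as the chain with transition operator `1 + Q / C`, where `C` bounds the total transition rate. -/
lemma exists_isStationary_of_drift (α : unitInterval) (β : ℕ) {V G : (Fin m → ℕ) → ℝ} {b : ℝ}
    (hV : 0 ≤ V) (hG : 0 ≤ G) (hfin : ∀ R, {n | G n ≤ R}.Finite)
    (hdrift : ∀ n, p.genFun α β V n ≤ b - G n) :
    ∃ ν : ProbabilityMeasure (Fin m → ℕ), p.IsStationary α β ν := by
  set C : ℝ := ∑ k, (β * p.lam k + β * p.mu k) + 1 with hC
  have hC0 : 0 < C := by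
    have : 0 ≤ ∑ k, (β * p.lam k + β * p.mu k) := Finset.sum_nonneg fun k _ =>
      add_nonneg (p.birthRate_nonneg β k) (mul_nonneg β.cast_nonneg (p.mu_pos k).le)
    linarith
  let P : ((Fin m → ℕ) → ℝ) →ₗ[ℝ] ((Fin m → ℕ) → ℝ) :=
    LinearMap.id + C⁻¹ •
      { toFun := p.genFun α β, map_add' := p.genFun_add α β, map_smul' := p.genFun_smul α β }
  have hP : ∀ f n, P f n = f n + C⁻¹ * p.genFun α β f n := fun f n => rfl
  obtain ⟨ν, hν, h⟩ : ∃ ν : Measure (Fin m → ℕ), IsProbabilityMeasure ν ∧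
      ∀ f : (Fin m → ℕ) → ℝ, (∃ K, ∀ n, |f n| ≤ K) → ∫ n, (P f - f) n ∂ν = 0 := by
    refine exists_invariant_of_drift P (V := V) (G := C⁻¹ • G) (b := C⁻¹ * b)
      (fun f hf n => ?_) ?_ hV (fun n => ?_) (fun R => ?_) fun n => ?_
    · have hlow : -(C * f n) ≤ p.genFun α β f n := by
        have h1 : -((C - 1) * f n) ≤ p.genFun α β f n := by
          rw [hC, add_sub_cancel_right, Finset.sum_mul, ← Finset.sum_neg_distrib]
          refine Finset.sum_le_sum fun k _ => ?_
          have hb := p.birthRate_nonneg β k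
          have hd := p.deathRate_nonneg α β n k
          have hd' : β * p.mu k * psi α (p.scale β n) k ≤ β * p.mu k :=
            mul_le_of_le_one_right (mul_nonneg β.cast_nonneg (p.mu_pos k).le)
              (psi_le_one α.2.1 (p.scale_nonneg β n) k)
          have e1 := mul_nonneg hb (hf (n + Pi.single k 1))
          have e2 := mul_nonneg hd (hf (n - Pi.single k 1))
          have e3 := mul_le_mul_of_nonneg_right hd' (hf n)
          linarith
        have := hf n
        simp only [Pi.zero_apply] at this
        linarith
      rw [Pi.zero_apply, hP]
      have := mul_le_mul_of_nonneg_left hlow (inv_nonneg.2 hC0.le)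
      rw [mul_neg, inv_mul_cancel_left₀ hC0.ne'] at this
      linarith
    · funext n
      rw [hP]
      simp [genFun]
    · exact mul_nonneg (inv_nonneg.2 hC0.le) (hG n)
    · refine (hfin (C * R)).subset fun n hn => ?_
      rwa [Set.mem_ofPred_eq, Pi.smul_apply, smul_eq_mul, inv_mul_le_iff₀ hC0] at hn
    · have := mul_le_mul_of_nonneg_left (hdrift n) (inv_nonneg.2 hC0.le)
      rw [hP, Pi.smul_apply, smul_eq_mul]
      linarith
  refine ⟨⟨ν, hν⟩, (p.isStationary_iff α β _).2 fun f => ?_⟩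
  have := h f ⟨‖f‖, fun n => f.norm_coe_le_norm n⟩
  have e : ∀ n, (P f - f) n = C⁻¹ * p.genFun α β f n := fun n => by
    rw [Pi.sub_apply, hP, add_sub_cancel_left]
  simp only [e, integral_const_mul] at this
  exact (mul_eq_zero.1 this).resolve_left (inv_ne_zero hC0.ne')

/-! ### Moment bounds from drift conditions -/

/-- The drift inequality `Q V ≤ r - g` for an unbounded `V` can be integrated against a stationary
distribution: truncating `V` at level `R` preserves it where `V < R` and makes `Q V` nonpositive
elsewhere. -/
lemma IsStationary.integral_le_of_drift {α : unitInterval} {β : ℕ}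
    {ν : ProbabilityMeasure (Fin m → ℕ)} (h : p.IsStationary α β ν) {V g r : (Fin m → ℕ) → ℝ}
    (hV : 0 ≤ V) (hg : 0 ≤ g) (hr : 0 ≤ r) (hri : Integrable r (ν : Measure (Fin m → ℕ)))
    (hd : ∀ n, p.genFun α β V n ≤ r n - g n) :
    Integrable g (ν : Measure (Fin m → ℕ)) ∧
      ∫ n, g n ∂(ν : Measure (Fin m → ℕ)) ≤ ∫ n, r n ∂(ν : Measure (Fin m → ℕ)) := by
  classical
  set gR : ℕ → (Fin m → ℕ) → ℝ := fun R n => if V n < R then min (g n) R else 0 with hgR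
  have hgR0 : ∀ R n, 0 ≤ gR R n := fun R n => by
    simp only [hgR]
    split_ifs
    · exact le_min (hg n) R.cast_nonneg
    · rfl
  have hgRle : ∀ R n, gR R n ≤ R := fun R n => by
    simp only [hgR]
    split_ifs
    · exact min_le_right _ _
    · exact R.cast_nonneg
  have hgRi : ∀ R, Integrable (gR R) (ν : Measure (Fin m → ℕ)) := fun R =>
    Integrable.of_bound (Measurable.of_discrete).aestronglyMeasurable R
      (Eventually.of_forall fun n => by
        rw [Real.norm_eq_abs, abs_of_nonneg (hgR0 R n)]
        exact hgRle R n)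
  have hle : ∀ R, ∫ n, gR R n ∂(ν : Measure (Fin m → ℕ)) ≤
      ∫ n, r n ∂(ν : Measure (Fin m → ℕ)) := fun R => by
    let f : (Fin m → ℕ) →ᵇ ℝ := BoundedContinuousFunction.ofNormedAddCommGroupDiscrete
      (fun n => min (V n) R) R (fun n => by
        rw [Real.norm_eq_abs, abs_of_nonneg (le_min (hV n) R.cast_nonneg)]
        exact min_le_right _ _)
    have hf : ∀ n, f n = min (V n) R := fun n => rfl
    have hgen : ∀ n, p.genFun α β f n ≤ r n - gR R n := fun n => by
      by_cases hn : V n < R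
      · have h1 : p.genFun α β f n ≤ p.genFun α β V n := by
          refine Finset.sum_le_sum fun k _ => ?_
          have hb := p.birthRate_nonneg β k
          have hd := p.deathRate_nonneg α β n k
          have hs : ∀ n', f n' - f n ≤ V n' - V n := fun n' => by
            rw [hf, hf, min_eq_left hn.le]
            linarith [min_le_left (V n') (R : ℝ)]
          exact add_le_add (mul_le_mul_of_nonneg_left (hs _) hb)
            (mul_le_mul_of_nonneg_left (hs _) hd)
        simp only [hgR, if_pos hn]
        linarith [hd n, min_le_left (g n) (R : ℝ)]
      · have h1 : p.genFun α β f n ≤ 0 := by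
          refine Finset.sum_nonpos fun k _ => ?_
          have hb := p.birthRate_nonneg β k
          have hd := p.deathRate_nonneg α β n k
          have hs : ∀ n', f n' - f n ≤ 0 := fun n' => by
            rw [hf, hf, min_eq_right (not_lt.1 hn)]
            linarith [min_le_right (V n') (R : ℝ)]
          exact add_nonpos (mul_nonpos_of_nonneg_of_nonpos hb (hs _))
            (mul_nonpos_of_nonneg_of_nonpos hd (hs _))
        simp only [hgR, if_neg hn, sub_zero]
        exact h1.trans (hr n)
    have h1 := integral_mono ((p.generator α β f).integrable (ν : Measure (Fin m → ℕ)))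
      (hri.sub (hgRi R)) hgen
    simp only [generator_apply, Pi.sub_apply] at h1
    rw [(p.isStationary_iff α β ν).1 h, integral_sub hri (hgRi R)] at h1
    linarith
  -- Fatou's lemma as the truncation level tends to infinity
  have hlint : ∫⁻ n, ENNReal.ofReal (g n) ∂(ν : Measure (Fin m → ℕ)) ≤
      ENNReal.ofReal (∫ n, r n ∂(ν : Measure (Fin m → ℕ))) := by
    have hpt : ∀ n, Tendsto (fun R => ENNReal.ofReal (gR R n)) atTop
        (𝓝 (ENNReal.ofReal (g n))) := fun n => by
      refine tendsto_const_nhds.congr' ?_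
      obtain ⟨R₀, hR₀⟩ := exists_nat_gt (max (V n) (g n))
      filter_upwards [eventually_ge_atTop R₀] with R hR
      have hR' : max (V n) (g n) < R := hR₀.trans_le (by exact_mod_cast hR)
      simp only [hgR]
      rw [if_pos ((le_max_left _ _).trans_lt hR'), min_eq_left ((le_max_right _ _).trans hR'.le)]
    calc _ = ∫⁻ n, liminf (fun R => ENNReal.ofReal (gR R n)) atTop
          ∂(ν : Measure (Fin m → ℕ)) := lintegral_congr fun n => (hpt n).liminf_eq.symm
      _ ≤ liminf (fun R => ∫⁻ n, ENNReal.ofReal (gR R n) ∂(ν : Measure (Fin m → ℕ))) atTop :=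
        lintegral_liminf_le fun R => Measurable.of_discrete
      _ ≤ _ := liminf_le_of_frequently_le' <| .of_forall fun R => by
        rw [← ofReal_integral_eq_lintegral_ofReal (hgRi R) (Eventually.of_forall (hgR0 R))]
        exact ENNReal.ofReal_le_ofReal (hle R)
  have hgi : Integrable g (ν : Measure (Fin m → ℕ)) := by
    refine ⟨(Measurable.of_discrete).aestronglyMeasurable, ?_⟩
    rw [hasFiniteIntegral_iff_ofReal (Eventually.of_forall hg)]
    exact hlint.trans_lt ENNReal.ofReal_lt_top
  refine ⟨hgi, ?_⟩
  rw [← ofReal_integral_eq_lintegral_ofReal hgi (Eventually.of_forall hg)] at hlint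
  exact (ENNReal.ofReal_le_ofReal_iff (integral_nonneg hr)).1 hlint

lemma genFun_comp_apply (α : unitInterval) (β : ℕ) (k : Fin m) (h : ℕ → ℝ) (n : Fin m → ℕ) :
    p.genFun α β (fun n => h (n k)) n = β * p.lam k * (h (n k + 1) - h (n k))
      + β * p.mu k * psi α (p.scale β n) k * (h (n k - 1) - h (n k)) := by
  unfold genFun
  rw [Finset.sum_eq_single k]
  · simp
  · intro j _ hj
    simp [Pi.single_eq_of_ne hj.symm]
  · simp

lemma genFun_sq_scale_sub (α : unitInterval) {β : ℕ} (hβ : 1 ≤ β) (k : Fin m) (c : ℝ)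
    (n : Fin m → ℕ) :
    p.genFun α β (fun n => (p.scale β n k - c) ^ 2) n =
      2 * p.a k * (p.scale β n k - c) * (p.lam k - p.mu k * psi α (p.scale β n) k)
        + p.a k ^ 2 * (p.lam k + p.mu k * psi α (p.scale β n) k) * (β : ℝ)⁻¹ := by
  have hβ0 : (β : ℝ) ≠ 0 := by
    have : β ≠ 0 := by omega
    exact_mod_cast this
  refine (p.genFun_comp_apply α β k (fun i => ((β : ℝ)⁻¹ * p.a k * i - c) ^ 2) n).trans ?_
  -- at `n k = 0` the truncated subtraction is multiplied by a vanishing death rate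
  rcases Nat.eq_zero_or_pos (n k) with hn | hn
  · have hx : p.scale β n k = 0 := by simp [scale, hn]
    rw [psi_eq_zero _ hx, hx, hn]
    push_cast
    field_simp
    ring
  · have hx : p.scale β n k = (β : ℝ)⁻¹ * p.a k * n k := rfl
    rw [hx]
    generalize psi α (p.scale β n) k = y
    rw [Nat.cast_sub hn]
    push_cast
    field_simp
    ring

/-- Quadratic drift of class `k` towards `γₖ(α)`, up to the deviation of the rate of class `0` at
link `k` from its equilibrium value and the fluctuations of order `1 / β`. -/
lemma genFun_sq_scale_sub_gamma_le (hρ : ∀ k, p.rho k < 1) (α : unitInterval) {β : ℕ}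
    (hβ : 1 ≤ β) (k : Fin m) (n : Fin m → ℕ) :
    p.genFun α β (fun n => (p.scale β n k - p.gamma α k) ^ 2) n ≤
      (2 * p.a k * p.mu k * (1 + p.gamma α k)
          * |theta α (p.scale β n) k.castSucc - theta α (p.gamma α) k.castSucc|
        + p.a k ^ 2 * (p.lam k + p.mu k) * (β : ℝ)⁻¹)
      - 2 * p.a k * p.mu k * (1 - p.rho k)
        * ((p.scale β n k - p.gamma α k) ^ 2 / (1 + p.scale β n k)) := by
  rw [p.genFun_sq_scale_sub α hβ]
  have hx := p.scale_nonneg β n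
  have hγ := p.gamma_nonneg α
  have ha := p.a_pos k
  have hm := p.mu_pos k
  have h1 := sub_mul_tailDrop_sub_ge (hx k) (hγ k) (theta_nonneg α.2.1 hx k.castSucc)
    (theta_nonneg α.2.1 hγ k.castSucc) (theta_le_one α.2.2 _ _) (p.rho_pos k).le (hρ k).le
    (p.psi_gamma hρ α k)
  change _ ≤ _ * (psi α (p.scale β n) k - _) at h1
  have h2 := psi_le_one α.2.1 hx k
  have e : p.lam k = p.mu k * p.rho k := by
    rw [rho, mul_div_cancel₀ _ hm.ne']
  have h3 : p.a k ^ 2 * (p.lam k + p.mu k * psi α (p.scale β n) k) * (β : ℝ)⁻¹ ≤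
      p.a k ^ 2 * (p.lam k + p.mu k) * (β : ℝ)⁻¹ := by
    gcongr
    exact mul_le_of_le_one_right hm.le h2
  have h4 := mul_le_mul_of_nonneg_left h1 (by positivity : 0 ≤ 2 * p.a k * p.mu k)
  have e' : 2 * p.a k * (p.scale β n k - p.gamma α k) *
      (p.lam k - p.mu k * psi α (p.scale β n) k) =
      -(2 * p.a k * p.mu k * ((p.scale β n k - p.gamma α k) *
        (psi α (p.scale β n) k - p.rho k))) := by
    rw [e]
    ring
  rw [e']
  linarith

lemma abs_theta_sub_le_one (α : unitInterval) {x y : Fin m → ℝ} (hx : ∀ k, 0 ≤ x k)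
    (hy : ∀ k, 0 ≤ y k) (i : Fin (m + 1)) : |theta α x i - theta α y i| ≤ 1 :=
  abs_le.2 ⟨by linarith [theta_nonneg α.2.1 hx i, theta_le_one α.2.2 y i],
    by linarith [theta_nonneg α.2.1 hy i, theta_le_one α.2.2 x i]⟩

/-- The weight `1 / (1 + x)` leaves linear growth of the quadratic, which is what makes the drift
coercive. -/
lemma le_add_sq_div {x c : ℝ} (hx : 0 ≤ x) : x ≤ 1 + 2 * c + (x - c) ^ 2 / (1 + x) := by
  have h : 0 < 1 + x := by linarith
  have e : 1 + 2 * c + (x - c) ^ 2 / (1 + x) - x = (1 + c) ^ 2 / (1 + x) := by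
    field_simp
    ring
  have : 0 ≤ (1 + c) ^ 2 / (1 + x) := by positivity
  linarith

lemma abs_sub_le_add_sq_div {x c δ : ℝ} (hx : 0 ≤ x) (hδ : 0 < δ) :
    |x - c| ≤ δ * (1 + x) + (4 * δ)⁻¹ * ((x - c) ^ 2 / (1 + x)) := by
  have h : 0 < 1 + x := by linarith
  rw [← sq_abs (x - c)]
  generalize |x - c| = y
  have e : δ * (1 + x) + (4 * δ)⁻¹ * (y ^ 2 / (1 + x)) - y
      = (2 * δ * (1 + x) - y) ^ 2 / (4 * δ * (1 + x)) := by
    field_simp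
    ring
  have : 0 ≤ (2 * δ * (1 + x) - y) ^ 2 / (4 * δ * (1 + x)) := by positivity
  linarith

lemma exists_isStationary (hρ : ∀ k, p.rho k < 1) (α : unitInterval) {β : ℕ} (hβ : 1 ≤ β) :
    ∃ ν : ProbabilityMeasure (Fin m → ℕ), p.IsStationary α β ν := by
  have hβ0 : (0 : ℝ) < β := by exact_mod_cast hβ
  set g : Fin m → (Fin m → ℕ) → ℝ := fun k n => 2 * p.a k * p.mu k * (1 - p.rho k)
        * ((p.scale β n k - p.gamma α k) ^ 2 / (1 + p.scale β n k)) with hg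
  have hc : ∀ k, 0 < 2 * p.a k * p.mu k * (1 - p.rho k) := fun k =>
    mul_pos (mul_pos (mul_pos two_pos (p.a_pos k)) (p.mu_pos k)) (by linarith [hρ k])
  have hg0 : ∀ k n, 0 ≤ g k n := fun k n => mul_nonneg (hc k).le
    (div_nonneg (sq_nonneg _) (by linarith [p.scale_nonneg β n k]))
  refine p.exists_isStationary_of_drift α β
    (V := ∑ k, fun n => (p.scale β n k - p.gamma α k) ^ 2) (G := ∑ k, g k)
    (b := ∑ k, (2 * p.a k * p.mu k * (1 + p.gamma α k)
        + p.a k ^ 2 * (p.lam k + p.mu k) * (β : ℝ)⁻¹))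
    (Finset.sum_nonneg fun k _ n => sq_nonneg _) (Finset.sum_nonneg fun k _ n => hg0 k n)
    (fun R => ?_) (fun n => ?_)
  · refine (Set.finite_Iic fun k => ⌊(1 + 2 * p.gamma α k
      + R / (2 * p.a k * p.mu k * (1 - p.rho k))) / ((β : ℝ)⁻¹ * p.a k)⌋₊).subset
      fun n hn k => Nat.le_floor ?_
    have ha := p.a_pos k
    have h1 : g k n ≤ R := by
      refine le_trans ?_ hn
      rw [Finset.sum_apply]
      exact Finset.single_le_sum (fun j _ => hg0 j n) (Finset.mem_univ k)
    rw [le_div_iff₀ (by positivity)]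
    have h2 : (p.scale β n k - p.gamma α k) ^ 2 / (1 + p.scale β n k)
        ≤ R / (2 * p.a k * p.mu k * (1 - p.rho k)) := by
      rw [le_div_iff₀ (hc k), mul_comm]
      exact h1
    have h3 := le_add_sq_div (c := p.gamma α k) (p.scale_nonneg β n k)
    have e : (n k : ℝ) * ((β : ℝ)⁻¹ * p.a k) = p.scale β n k := by
      unfold scale
      ring
    linarith
  · rw [genFun_sum, Finset.sum_apply, Finset.sum_apply, ← Finset.sum_sub_distrib]
    refine Finset.sum_le_sum fun k _ => (p.genFun_sq_scale_sub_gamma_le hρ α hβ k n).trans ?_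
    have h1 := abs_theta_sub_le_one α (p.scale_nonneg β n) (p.gamma_nonneg α) k.castSucc
    have h2 : 0 ≤ 2 * p.a k * p.mu k * (1 + p.gamma α k) :=
      mul_nonneg (mul_nonneg (mul_nonneg zero_le_two (p.a_pos k).le) (p.mu_pos k).le)
        (by linarith [p.gamma_nonneg α k])
    have h3 := mul_le_of_le_one_right h2 h1
    simp only [hg]
    linarith

/-! ### Concentration at the fixed point, uniformly in `α` -/

/-- The ratio of the perturbation coefficients to the coefficient of the quadratic term in
`genFun_sq_scale_sub_gamma_le`, made uniform in `α` by `γₖ(α) ≤ ρₖ / (1 - ρₖ)`. -/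
noncomputable def driftConst (k : Fin m) : ℝ :=
  (2 * p.a k * p.mu k * (1 + p.rho k / (1 - p.rho k)) + p.a k ^ 2 * (p.lam k + p.mu k))
    / (2 * p.a k * p.mu k * (1 - p.rho k))

lemma driftConst_nonneg (hρ : ∀ k, p.rho k < 1) (k : Fin m) : 0 ≤ p.driftConst k := by
  have h1 : 0 < 1 - p.rho k := by linarith [hρ k]
  have := p.rho_pos k
  have := p.a_pos k
  have := p.mu_pos k
  have := p.lam_pos k
  unfold driftConst
  positivity

lemma integrable_abs_theta_sub (α : unitInterval) (β : ℕ) (ν : ProbabilityMeasure (Fin m → ℕ))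
    (i : Fin (m + 1)) :
    Integrable (fun n => |theta α (p.scale β n) i - theta α (p.gamma α) i|)
      (ν : Measure (Fin m → ℕ)) :=
  Integrable.of_bound (Measurable.of_discrete).aestronglyMeasurable 1
    (Eventually.of_forall fun n => by
      rw [Real.norm_eq_abs, abs_abs]
      exact abs_theta_sub_le_one α (p.scale_nonneg β n) (p.gamma_nonneg α) i)

lemma integral_abs_theta_sub_le_one (α : unitInterval) (β : ℕ)
    (ν : ProbabilityMeasure (Fin m → ℕ)) (i : Fin (m + 1)) :
    ∫ n, |theta α (p.scale β n) i - theta α (p.gamma α) i| ∂(ν : Measure (Fin m → ℕ)) ≤ 1 := by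
  have := integral_mono (p.integrable_abs_theta_sub α β ν i)
    (integrable_const (μ := (ν : Measure (Fin m → ℕ))) (1 : ℝ))
    fun n => abs_theta_sub_le_one α (p.scale_nonneg β n) (p.gamma_nonneg α) i
  simpa using this

lemma IsStationary.integral_sq_div_le (hρ : ∀ k, p.rho k < 1) {α : unitInterval} {β : ℕ}
    (hβ : 1 ≤ β) {ν : ProbabilityMeasure (Fin m → ℕ)} (h : p.IsStationary α β ν) (k : Fin m) :
    Integrable (fun n => (p.scale β n k - p.gamma α k) ^ 2 / (1 + p.scale β n k))
      (ν : Measure (Fin m → ℕ)) ∧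
    ∫ n, (p.scale β n k - p.gamma α k) ^ 2 / (1 + p.scale β n k) ∂(ν : Measure (Fin m → ℕ)) ≤
      p.driftConst k *
        (∫ n, |theta α (p.scale β n) k.castSucc - theta α (p.gamma α) k.castSucc|
          ∂(ν : Measure (Fin m → ℕ)) + (β : ℝ)⁻¹) := by
  have ha := p.a_pos k
  have hm := p.mu_pos k
  have hl := p.lam_pos k
  have hγ := p.gamma_nonneg α k
  have h1 : 0 < 1 - p.rho k := by linarith [hρ k]
  have hρ0 := p.rho_pos k
  have hc : 0 < 2 * p.a k * p.mu k * (1 - p.rho k) := by positivity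
  have hti := p.integrable_abs_theta_sub α β ν k.castSucc
  have hri : Integrable (fun n => 2 * p.a k * p.mu k * (1 + p.gamma α k)
          * |theta α (p.scale β n) k.castSucc - theta α (p.gamma α) k.castSucc|
        + p.a k ^ 2 * (p.lam k + p.mu k) * (β : ℝ)⁻¹) (ν : Measure (Fin m → ℕ)) :=
    (hti.const_mul _).add (integrable_const _)
  obtain ⟨hi, hle⟩ := IsStationary.integral_le_of_drift p h
    (V := fun n => (p.scale β n k - p.gamma α k) ^ 2)
    (g := fun n => 2 * p.a k * p.mu k * (1 - p.rho k)
        * ((p.scale β n k - p.gamma α k) ^ 2 / (1 + p.scale β n k)))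
    (fun n => sq_nonneg _)
    (fun n => mul_nonneg hc.le (div_nonneg (sq_nonneg _) (by linarith [p.scale_nonneg β n k])))
    (fun n => by simp only [Pi.zero_apply]; positivity) hri
    (p.genFun_sq_scale_sub_gamma_le hρ α hβ k)
  refine ⟨?_, ?_⟩
  · have := hi.const_mul (2 * p.a k * p.mu k * (1 - p.rho k))⁻¹
    simpa only [inv_mul_cancel_left₀ hc.ne'] using this
  · rw [integral_const_mul, integral_add (hti.const_mul _) (integrable_const _),
      integral_const_mul, integral_const, probReal_univ, one_smul] at hle
    have ht0 : 0 ≤ ∫ n, |theta α (p.scale β n) k.castSucc - theta α (p.gamma α) k.castSucc|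
          ∂(ν : Measure (Fin m → ℕ)) := integral_nonneg fun n => abs_nonneg _
    have hγle := p.gamma_le hρ α k
    generalize ∫ n, |theta α (p.scale β n) k.castSucc - theta α (p.gamma α) k.castSucc|
          ∂(ν : Measure (Fin m → ℕ)) = T at *
    have hβ0 : 0 ≤ (β : ℝ)⁻¹ := by positivity
    rw [driftConst, div_mul_eq_mul_div, le_div_iff₀ hc, mul_comm]
    refine hle.trans ?_
    have e1 : 2 * p.a k * p.mu k * (1 + p.gamma α k) * T ≤
        2 * p.a k * p.mu k * (1 + p.rho k / (1 - p.rho k)) * T := by gcongr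
    have e2 : 0 ≤ p.a k ^ 2 * (p.lam k + p.mu k) * T := by positivity
    have e3 : 0 ≤ 2 * p.a k * p.mu k * (1 + p.rho k / (1 - p.rho k)) * (β : ℝ)⁻¹ := by positivity
    linarith

/-- A bound, uniform in `α` and `β`, for the mean of the input rate of class `k`. -/
noncomputable def meanBound (k : Fin m) : ℝ :=
  1 + 2 * (p.rho k / (1 - p.rho k)) + 2 * p.driftConst k

lemma meanBound_nonneg (hρ : ∀ k, p.rho k < 1) (k : Fin m) : 0 ≤ p.meanBound k := by
  have h1 : 0 < 1 - p.rho k := by linarith [hρ k]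
  have := p.rho_pos k
  have := p.driftConst_nonneg hρ k
  unfold meanBound
  positivity

lemma IsStationary.integral_scale_le (hρ : ∀ k, p.rho k < 1) {α : unitInterval} {β : ℕ}
    (hβ : 1 ≤ β) {ν : ProbabilityMeasure (Fin m → ℕ)} (h : p.IsStationary α β ν) (k : Fin m) :
    Integrable (fun n => p.scale β n k) (ν : Measure (Fin m → ℕ)) ∧
    ∫ n, p.scale β n k ∂(ν : Measure (Fin m → ℕ)) ≤ p.meanBound k := by
  obtain ⟨hi, hle⟩ := h.integral_sq_div_le p hρ hβ k
  have hgi : Integrable (fun n => 1 + 2 * p.gamma α k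
      + (p.scale β n k - p.gamma α k) ^ 2 / (1 + p.scale β n k)) (ν : Measure (Fin m → ℕ)) :=
    (integrable_const _).add hi
  have hpt : ∀ n, p.scale β n k ≤ 1 + 2 * p.gamma α k
      + (p.scale β n k - p.gamma α k) ^ 2 / (1 + p.scale β n k) :=
    fun n => le_add_sq_div (p.scale_nonneg β n k)
  have hxi : Integrable (fun n => p.scale β n k) (ν : Measure (Fin m → ℕ)) :=
    hgi.mono' (Measurable.of_discrete).aestronglyMeasurable (Eventually.of_forall fun n => by
      rw [Real.norm_eq_abs, abs_of_nonneg (p.scale_nonneg β n k)]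
      exact hpt n)
  refine ⟨hxi, (integral_mono hxi hgi hpt).trans ?_⟩
  rw [integral_add (integrable_const _) hi, integral_const, probReal_univ, one_smul, meanBound]
  have h1 := p.integral_abs_theta_sub_le_one α β ν k.castSucc
  have h2 : (β : ℝ)⁻¹ ≤ 1 := inv_le_one_of_one_le₀ (by exact_mod_cast hβ)
  have h3 := mul_le_mul_of_nonneg_left (add_le_add h1 h2) (p.driftConst_nonneg hρ k)
  linarith [p.gamma_le hρ α k]

lemma IsStationary.integrable_abs_scale_sub (hρ : ∀ k, p.rho k < 1) {α : unitInterval} {β : ℕ}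
    (hβ : 1 ≤ β) {ν : ProbabilityMeasure (Fin m → ℕ)} (h : p.IsStationary α β ν) (k : Fin m) :
    Integrable (fun n => |p.scale β n k - p.gamma α k|) (ν : Measure (Fin m → ℕ)) :=
  ((h.integral_scale_le p hρ hβ k).1.sub (integrable_const _)).abs

lemma IsStationary.integral_abs_scale_sub_le (hρ : ∀ k, p.rho k < 1) {α : unitInterval} {β : ℕ}
    (hβ : 1 ≤ β) {ν : ProbabilityMeasure (Fin m → ℕ)} (h : p.IsStationary α β ν) (k : Fin m)
    {δ : ℝ} (hδ : 0 < δ) :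
    ∫ n, |p.scale β n k - p.gamma α k| ∂(ν : Measure (Fin m → ℕ)) ≤
      δ * (1 + p.meanBound k) + (4 * δ)⁻¹ * (p.driftConst k *
        (∫ n, |theta α (p.scale β n) k.castSucc - theta α (p.gamma α) k.castSucc|
          ∂(ν : Measure (Fin m → ℕ)) + (β : ℝ)⁻¹)) := by
  obtain ⟨hi, hle⟩ := h.integral_sq_div_le p hρ hβ k
  obtain ⟨hxi, hxle⟩ := h.integral_scale_le p hρ hβ k
  have h1i : Integrable (fun n => δ * (1 + p.scale β n k)) (ν : Measure (Fin m → ℕ)) :=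
    ((integrable_const _).add hxi).const_mul _
  refine (integral_mono (h.integrable_abs_scale_sub p hρ hβ k) (h1i.add (hi.const_mul (4 * δ)⁻¹))
    fun n => abs_sub_le_add_sq_div (p.scale_nonneg β n k) hδ).trans ?_
  simp only [Pi.add_apply]
  rw [integral_add h1i (hi.const_mul _), integral_const_mul, integral_const_mul,
    integral_add (integrable_const _) hxi, integral_const, probReal_univ, one_smul]
  gcongr

/-- One step along the network: concentration of the rate of class `0` at the input of a link
implies concentration of the local class. -/
lemma eventually_integral_abs_scale_sub_le (hρ : ∀ k, p.rho k < 1) (k : Fin m)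
    (hθ : ∀ ε : ℝ, 0 < ε → ∀ᶠ β : ℕ in atTop, ∀ (α : unitInterval)
      (ν : ProbabilityMeasure (Fin m → ℕ)), p.IsStationary α β ν →
        ∫ n, |theta α (p.scale β n) k.castSucc - theta α (p.gamma α) k.castSucc|
          ∂(ν : Measure (Fin m → ℕ)) ≤ ε) {ε : ℝ} (hε : 0 < ε) :
    ∀ᶠ β : ℕ in atTop, ∀ (α : unitInterval) (ν : ProbabilityMeasure (Fin m → ℕ)),
      p.IsStationary α β ν →
        ∫ n, |p.scale β n k - p.gamma α k| ∂(ν : Measure (Fin m → ℕ)) ≤ ε := by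
  have hM := p.meanBound_nonneg hρ k
  have hA := p.driftConst_nonneg hρ k
  -- `δ` makes the first term of `integral_abs_scale_sub_le` equal to `ε / 2`; `η` then keeps the
  -- second one below `ε / 2`
  set δ : ℝ := ε / (2 * (1 + p.meanBound k)) with hδ
  have hδ0 : 0 < δ := by positivity
  set η : ℝ := ε * δ / (1 + p.driftConst k) with hη
  have hη0 : 0 < η := by positivity
  have hinv : ∀ᶠ β : ℕ in atTop, (β : ℝ)⁻¹ ≤ η :=
    (tendsto_inv_atTop_nhds_zero_nat (𝕜 := ℝ)).eventually (eventually_le_nhds hη0)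
  filter_upwards [hθ η hη0, hinv, eventually_ge_atTop 1] with β h1 h2 hβ α ν h
  refine (h.integral_abs_scale_sub_le p hρ hβ k hδ0).trans ?_
  have e1 : δ * (1 + p.meanBound k) = ε / 2 := by
    rw [hδ]
    field_simp
  have e2 : (4 * δ)⁻¹ * (p.driftConst k * (η + η)) ≤ ε / 2 := by
    have : (4 * δ)⁻¹ * (p.driftConst k * (η + η))
        = ε / 2 * (p.driftConst k / (1 + p.driftConst k)) := by
      rw [hη]
      field_simp
      ring
    rw [this]
    exact mul_le_of_le_one_right (by positivity) (div_le_one_of_le₀ (by linarith) (by positivity))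
  have e3 := h1 α ν h
  rw [e1]
  refine (add_le_add_right (le_trans ?_ e2) _).trans_eq (add_halves ε)
  gcongr

/-- Concentration of the rate of class `0`, link after link: its output rate on a link is a
Lipschitz function of its input rate and of the input rate of the local class. -/
lemma eventually_integral_abs_theta_sub_le (hρ : ∀ k, p.rho k < 1) (i : Fin (m + 1)) :
    ∀ ε : ℝ, 0 < ε → ∀ᶠ β : ℕ in atTop, ∀ (α : unitInterval)
      (ν : ProbabilityMeasure (Fin m → ℕ)), p.IsStationary α β ν →
        ∫ n, |theta α (p.scale β n) i - theta α (p.gamma α) i| ∂(ν : Measure (Fin m → ℕ)) ≤ ε := by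
  induction i using Fin.induction with
  | zero =>
    intro ε hε
    refine Eventually.of_forall fun β α ν _ => ?_
    simpa using hε.le
  | succ k ih =>
    intro ε hε
    filter_upwards [ih (ε / 4) (by positivity), eventually_ge_atTop 1,
      p.eventually_integral_abs_scale_sub_le hρ k ih (half_pos hε)] with β h1 hβ h2 α ν h
    have hti := p.integrable_abs_theta_sub α β ν k.castSucc
    have hxi := h.integrable_abs_scale_sub p hρ hβ k
    have hle : ∀ n, |theta α (p.scale β n) k.succ - theta α (p.gamma α) k.succ| ≤
        2 * |theta α (p.scale β n) k.castSucc - theta α (p.gamma α) k.castSucc|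
          + |p.scale β n k - p.gamma α k| := fun n => by
      rw [theta_succ, theta_succ]
      exact abs_tailDrop_sub_le (theta_nonneg α.2.1 (p.scale_nonneg β n) _)
        (p.scale_nonneg β n k) (theta_nonneg α.2.1 (p.gamma_nonneg α) _) (p.gamma_nonneg α k)
    refine (integral_mono (p.integrable_abs_theta_sub α β ν k.succ) ((hti.const_mul 2).add hxi)
      hle).trans ?_
    simp only [Pi.add_apply]
    rw [integral_add (hti.const_mul 2) hxi, integral_const_mul]
    linarith [h1 α ν h, h2 α ν h]

lemma eventually_sum_integral_abs_scale_sub_le (hρ : ∀ k, p.rho k < 1) {ε : ℝ} (hε : 0 < ε) :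
    ∀ᶠ β : ℕ in atTop, ∀ (α : unitInterval) (ν : ProbabilityMeasure (Fin m → ℕ)),
      p.IsStationary α β ν →
        ∑ k, ∫ n, |p.scale β n k - p.gamma α k| ∂(ν : Measure (Fin m → ℕ)) ≤ ε := by
  have h : ∀ k : Fin m, ∀ᶠ β : ℕ in atTop, ∀ (α : unitInterval)
      (ν : ProbabilityMeasure (Fin m → ℕ)), p.IsStationary α β ν →
        ∫ n, |p.scale β n k - p.gamma α k| ∂(ν : Measure (Fin m → ℕ)) ≤ ε / (m + 1) := fun k =>
    p.eventually_integral_abs_scale_sub_le hρ k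
      (p.eventually_integral_abs_theta_sub_le hρ k.castSucc) (by positivity)
  filter_upwards [eventually_all.2 h] with β hβ α ν hν
  refine (Finset.sum_le_sum fun k _ => hβ k α ν hν).trans ?_
  rw [Finset.sum_const, Finset.card_univ, Fintype.card_fin, nsmul_eq_mul, ← mul_div_assoc,
    div_le_iff₀ (by positivity)]
  nlinarith

/-! ### Tightness and limits -/

lemma toMeasure_scaledLaw (β : ℕ) (ν : ProbabilityMeasure (Fin m → ℕ)) :
    (p.scaledLaw β ν : Measure (Fin m → ℝ)) = (ν : Measure (Fin m → ℕ)).map (p.scale β) := rfl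

lemma isTightMeasureSet_scaledLaw (hρ : ∀ k, p.rho k < 1) :
    IsTightMeasureSet {π : Measure (Fin m → ℝ) | ∃ (α : unitInterval) (β : ℕ)
      (ν : ProbabilityMeasure (Fin m → ℕ)), 1 ≤ β ∧ p.IsStationary α β ν ∧
        π = (p.scaledLaw β ν : Measure (Fin m → ℝ))} := by
  rw [isTightMeasureSet_iff_exists_isCompact_measure_compl_le]
  intro ε hε
  rcases eq_or_ne ε ⊤ with rfl | hε'
  · exact ⟨∅, isCompact_empty, fun _ _ => le_top⟩
  have hε0 : 0 < ε.toReal := ENNReal.toReal_pos hε.ne' hε'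
  set B : ℝ := ∑ k, p.meanBound k with hB
  have hB0 : 0 ≤ B := Finset.sum_nonneg fun k _ => p.meanBound_nonneg hρ k
  set R : ℝ := B / ε.toReal + 1 with hR
  have hR0 : 0 < R := by positivity
  refine ⟨Metric.closedBall 0 R, isCompact_closedBall _ _, ?_⟩
  rintro π ⟨α, β, ν, hβ, hν, rfl⟩
  rw [toMeasure_scaledLaw, Measure.map_apply Measurable.of_discrete
    Metric.isClosed_closedBall.measurableSet.compl]
  have hsub : p.scale β ⁻¹' (Metric.closedBall 0 R)ᶜ ⊆ {n | R ≤ ∑ k, p.scale β n k} := by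
    intro n hn
    by_contra! hlt
    refine hn ?_
    rw [Metric.mem_closedBall, dist_zero_right, pi_norm_le_iff_of_nonneg hR0.le]
    intro k
    rw [Real.norm_eq_abs, abs_of_nonneg (p.scale_nonneg β n k)]
    have hlt' : ∑ k, p.scale β n k < R := not_le.1 hlt
    exact (Finset.single_le_sum (fun j _ => p.scale_nonneg β n j) (Finset.mem_univ k)).trans hlt'.le
  refine (measure_mono hsub).trans ?_
  have hi : ∀ k ∈ Finset.univ, Integrable (fun n => p.scale β n k) (ν : Measure (Fin m → ℕ)) :=
    fun k _ => (hν.integral_scale_le p hρ hβ k).1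
  have hmarkov := mul_meas_ge_le_integral_of_nonneg (μ := (ν : Measure (Fin m → ℕ)))
    (Eventually.of_forall fun n => Finset.sum_nonneg fun k _ => p.scale_nonneg β n k)
    (integrable_finsetSum _ hi) R
  rw [integral_finsetSum _ hi] at hmarkov
  have hle : (ν : Measure (Fin m → ℕ)).real {n | R ≤ ∑ k, p.scale β n k} ≤ ε.toReal := by
    have h1 : R * (ν : Measure (Fin m → ℕ)).real {n | R ≤ ∑ k, p.scale β n k} ≤ B :=
      hmarkov.trans (Finset.sum_le_sum fun k _ => (hν.integral_scale_le p hρ hβ k).2)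
    rw [mul_comm, ← le_div_iff₀ hR0] at h1
    refine h1.trans ?_
    rw [div_le_iff₀ hR0, hR, mul_add, mul_div_cancel₀ _ hε0.ne']
    linarith
  exact (ENNReal.toReal_le_toReal (measure_ne_top (ν : Measure (Fin m → ℕ)) _) hε').1 hle

lemma tendsto_scaledLaw (hρ : ∀ k, p.rho k < 1) (α : unitInterval)
    {ν : ℕ → ProbabilityMeasure (Fin m → ℕ)} (hν : ∀ β, 1 ≤ β → p.IsStationary α β (ν β)) :
    Tendsto (fun β : ℕ => p.scaledLaw β (ν β)) atTop
      (𝓝 (⟨Measure.dirac (p.gamma α), inferInstance⟩ : ProbabilityMeasure (Fin m → ℝ))) := by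
  refine ProbabilityMeasure.tendsto_iff_forall_integral_tendsto.2 fun f => ?_
  suffices h : Tendsto (fun β => ∫ x, f x ∂(p.scaledLaw β (ν β) : Measure (Fin m → ℝ))) atTop
      (𝓝 (f (p.gamma α))) by
    rw [← integral_dirac f (p.gamma α)] at h
    exact h
  rw [Metric.tendsto_atTop']
  intro ε hε
  obtain ⟨δ, hδ, hfδ⟩ := Metric.continuousAt_iff.1 (f.continuous.continuousAt (x := p.gamma α))
    (ε / 2) (half_pos hε)
  set c : ℝ := 2 * ‖f‖ / δ with hc
  have hc0 : 0 ≤ c := by positivity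
  -- continuity at `γ(α)` near that point, and a linear bound for the bounded function `f` far away
  have hpt : ∀ x, |f x - f (p.gamma α)| ≤ ε / 2 + c * ∑ k, |x k - p.gamma α k| := by
    intro x
    have hs : 0 ≤ ∑ k, |x k - p.gamma α k| := Finset.sum_nonneg fun k _ => abs_nonneg _
    by_cases hx : dist x (p.gamma α) < δ
    · have h1 : |f x - f (p.gamma α)| < ε / 2 := hfδ hx
      have h2 := mul_nonneg hc0 hs
      linarith
    · have h1 : dist x (p.gamma α) ≤ ∑ k, |x k - p.gamma α k| :=
        (dist_pi_le_iff hs).2 fun k =>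
          Finset.single_le_sum (f := fun k => |x k - p.gamma α k|) (fun j _ => abs_nonneg _)
            (Finset.mem_univ k)
      have h2 : |f x - f (p.gamma α)| ≤ 2 * ‖f‖ := f.dist_le_two_norm _ _
      have h3 : 2 * ‖f‖ = c * δ := by
        rw [hc]
        field_simp
      have h4 : c * δ ≤ c * ∑ k, |x k - p.gamma α k| :=
        mul_le_mul_of_nonneg_left ((not_lt.1 hx).trans h1) hc0
      linarith
  set η : ℝ := ε / (4 * (1 + c)) with hη
  have hη0 : 0 < η := by positivity
  have hcη : c * η < ε / 2 := by
    have : c * η = ε / 4 * (c / (1 + c)) := by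
      rw [hη]
      field_simp
    rw [this]
    have h1 : c / (1 + c) ≤ 1 := div_le_one_of_le₀ (by linarith) (by positivity)
    nlinarith
  obtain ⟨β₀, hβ₀⟩ := eventually_atTop.1 ((p.eventually_sum_integral_abs_scale_sub_le hρ hη0).and
    (eventually_ge_atTop 1))
  refine ⟨β₀, fun β hβ => ?_⟩
  obtain ⟨hsum, hβ1⟩ := hβ₀ β hβ.le
  have hst := hν β hβ1
  rw [toMeasure_scaledLaw, integral_map Measurable.of_discrete.aemeasurable
    f.continuous.aestronglyMeasurable]
  have hfi : Integrable (fun n => f (p.scale β n)) (ν β : Measure (Fin m → ℕ)) :=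
    Integrable.of_bound (Measurable.of_discrete).aestronglyMeasurable ‖f‖
      (Eventually.of_forall fun n => f.norm_coe_le_norm _)
  have hi : ∀ k ∈ Finset.univ, Integrable (fun n => |p.scale β n k - p.gamma α k|)
      (ν β : Measure (Fin m → ℕ)) := fun k _ => hst.integrable_abs_scale_sub p hρ hβ1 k
  have hsub : ∫ n, f (p.scale β n) ∂(ν β : Measure (Fin m → ℕ)) - f (p.gamma α)
      = ∫ n, (f (p.scale β n) - f (p.gamma α)) ∂(ν β : Measure (Fin m → ℕ)) := by
    rw [integral_sub hfi (integrable_const _), integral_const, probReal_univ, one_smul]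
  rw [Real.dist_eq, hsub]
  refine abs_integral_le_integral_abs.trans_lt ?_
  refine (integral_mono (hfi.sub (integrable_const _)).abs
    ((integrable_const (ε / 2)).add ((integrable_finsetSum _ hi).const_mul c))
    fun n => hpt (p.scale β n)).trans_lt ?_
  simp only [Pi.add_apply]
  rw [integral_add (integrable_const _) ((integrable_finsetSum _ hi).const_mul c),
    integral_const, probReal_univ, one_smul, integral_const_mul, integral_finsetSum _ hi]
  have := mul_le_mul_of_nonneg_left (hsum α (ν β) hst) hc0
  linarith

lemma abs_phiBar_sub_phiLim_le (hρ : ∀ k, p.rho k < 1) (α : unitInterval) (β : ℕ)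
    (ν : ProbabilityMeasure (Fin m → ℕ)) :
    |phiBar α (p.scaledLaw β ν) - p.phiLim α| ≤
      ∫ n, |theta α (p.scale β n) (Fin.last m) - theta α (p.gamma α) (Fin.last m)|
        ∂(ν : Measure (Fin m → ℕ)) := by
  have hi : Integrable (fun n => theta α (p.scale β n) (Fin.last m)) (ν : Measure (Fin m → ℕ)) :=
    Integrable.of_bound (Measurable.of_discrete).aestronglyMeasurable 1
      (Eventually.of_forall fun n => by
        rw [Real.norm_eq_abs, abs_of_nonneg (theta_nonneg α.2.1 (p.scale_nonneg β n) _)]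
        exact theta_le_one α.2.2 _ _)
  have e : phiBar α (p.scaledLaw β ν) - p.phiLim α =
      ∫ n, (theta α (p.scale β n) (Fin.last m) - theta α (p.gamma α) (Fin.last m))
        ∂(ν : Measure (Fin m → ℕ)) := by
    rw [integral_sub hi (integrable_const _), integral_const, probReal_univ, one_smul, phiBar,
      toMeasure_scaledLaw, ← p.psiZero_gamma hρ]
    unfold psiZero
    rw [integral_map Measurable.of_discrete.aemeasurable
      (measurable_theta α (Fin.last m)).aestronglyMeasurable]
  rw [e]
  exact abs_integral_le_integral_abs

/-- The throughput of class `0` converges uniformly in `α`. -/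
lemma eventually_abs_phiBar_sub_phiLim_le (hρ : ∀ k, p.rho k < 1) {ε : ℝ} (hε : 0 < ε) :
    ∀ᶠ β : ℕ in atTop, ∀ (α : unitInterval) (ν : ProbabilityMeasure (Fin m → ℕ)),
      p.IsStationary α β ν → |phiBar α (p.scaledLaw β ν) - p.phiLim α| ≤ ε := by
  filter_upwards [p.eventually_integral_abs_theta_sub_le hρ (Fin.last m) ε hε] with β hβ α ν hν
  exact (p.abs_phiBar_sub_phiLim_le hρ α β ν).trans (hβ α ν hν)

end LinearNetwork

theorem mainTheorem7 {m : ℕ} (p : LinearNetwork m) (hρ : ∀ k, p.rho k < 1) :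
    -- the stationary distributions exist and are unique
    (∀ (α : unitInterval) (β : ℕ), 1 ≤ β →
      ∃! ν : ProbabilityMeasure (Fin m → ℕ), p.IsStationary α β ν) ∧
    -- `γ(α)` is the unique fixed point in the nonnegative orthant
    (∀ (α : unitInterval) (x : Fin m → ℝ), (∀ k, 0 ≤ x k) →
      ((∀ k, p.lam k - p.mu k * LinearNetwork.psi α x k = 0) ↔ x = p.gamma α)) ∧
    (∀ α k, 0 ≤ p.gamma α k) ∧
    ∀ ν : unitInterval → ℕ → ProbabilityMeasure (Fin m → ℕ),
      (∀ (α : unitInterval) (β : ℕ), 1 ≤ β → p.IsStationary α β (ν α β)) →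
      IsTightMeasureSet {π : Measure (Fin m → ℝ) |
        ∃ (α : unitInterval) (β : ℕ), 1 ≤ β ∧ π = (p.scaledLaw β (ν α β) : Measure (Fin m → ℝ))} ∧
      (∀ α : unitInterval, Tendsto (fun β : ℕ => p.scaledLaw β (ν α β)) atTop
        (𝓝 (⟨Measure.dirac (p.gamma α), inferInstance⟩ : ProbabilityMeasure (Fin m → ℝ)))) ∧
      (∀ α : unitInterval, Tendsto
        (fun β : ℕ => LinearNetwork.phiBar α (p.scaledLaw β (ν α β))) atTop (𝓝 (p.phiLim α))) ∧
      (∀ α : unitInterval, Tendsto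
        (fun β : ℕ => sInf ((fun u : unitInterval =>
          LinearNetwork.phiBar u (p.scaledLaw β (ν u β))) '' Set.Icc α 1))
        atTop (𝓝 (p.phiLim α))) := by
  refine ⟨fun α β hβ => ?_, fun α x hx => p.eq_gamma_iff hρ α hx, p.gamma_nonneg, fun ν hν => ?_⟩
  · obtain ⟨ν, h⟩ := p.exists_isStationary hρ α hβ
    exact ⟨ν, h, fun ν' h' => LinearNetwork.IsStationary.unique p hβ h' h⟩
  refine ⟨?_, fun α => p.tendsto_scaledLaw hρ α (hν α), fun α => ?_, fun α => ?_⟩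
  · refine (p.isTightMeasureSet_scaledLaw hρ).subset ?_
    rintro π ⟨α, β, hβ, rfl⟩
    exact ⟨α, β, ν α β, hβ, hν α β hβ, rfl⟩
  · rw [Metric.tendsto_nhds]
    intro ε hε
    filter_upwards [p.eventually_abs_phiBar_sub_phiLim_le hρ (half_pos hε),
      eventually_ge_atTop 1] with β h hβ
    exact (h α _ (hν α β hβ)).trans_lt (half_lt_self hε)
  · rw [Metric.tendsto_nhds]
    intro ε hε
    filter_upwards [p.eventually_abs_phiBar_sub_phiLim_le hρ (half_pos hε),
      eventually_ge_atTop 1] with β h hβ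
    have hlow : ∀ y ∈ (fun u : unitInterval =>
        LinearNetwork.phiBar u (p.scaledLaw β (ν u β))) '' Set.Icc α 1, p.phiLim α - ε / 2 ≤ y := by
      rintro _ ⟨u, hu, rfl⟩
      have h1 := (abs_le.1 (h u _ (hν u β hβ))).1
      have h2 := p.phiLim_mono hu.1
      linarith
    have hmem : LinearNetwork.phiBar α (p.scaledLaw β (ν α β)) ∈ (fun u : unitInterval =>
        LinearNetwork.phiBar u (p.scaledLaw β (ν u β))) '' Set.Icc α 1 :=
      ⟨α, ⟨le_rfl, α.2.2⟩, rfl⟩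
    have h1 := le_csInf ⟨_, hmem⟩ hlow
    have h2 := csInf_le ⟨_, hlow⟩ hmem
    have h3 := (abs_le.1 (h α _ (hν α β hβ))).2
    rw [Real.dist_eq, abs_lt]
    constructor <;> linarith
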